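/- Let $d\ge 1$ be an integer, $0<s<d$, $q\neq 0$ real, and $R\in(0,1)\cup(1,\infty)$. Let $\mathbb{S}^d\subset\mathbb{R}^{d+1}$ be the unit sphere, $\sigma_d$ its normalized surface area measure, $\mathbf{a}=(\mathbf{0},R)\in\mathbb{R}^{d+1}$, and let $Q(\mathbf{x})=q/|\mathbf{x}-\mathbf{a}|^s$ be the external field on $\mathbb{S}^d$. For a positive measure $\mu$ put $U_s^{\mu}(\mathbf{x})=\int|\mathbf{x}-\mathbf{y}|^{-s}\,d\mu(\mathbf{y})$ and $\mathcal{I}_s[\mu]=\int U_s^{\mu}\,d\mu$, define $U_s^\eta$ for a signed measure $\eta$ by the same formula (at points where the integral converges absolutely), and write $U_s^{\sigma_d}(R)=U_s^{\sigma_d}(\mathbf{a})$ and $W_s(\mathbb{S}^d)=\inf\mathcal{I}_s[\mu]$, the infimum over all Borel probability measures $\mu$ on $\mathbb{S}^d$; both numbers are finite. A signed $s$-equilibrium on $\mathbb{S}^d$ associated with $Q$ is a finite signed Borel measure $\eta$ on $\mathbb{S}^d$ with $\eta(\mathbb{S}^d)=1$ such that $U_s^{\eta}+Q$ exists as a finite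 number and is constant everywhere on $\mathbb{S}^d$. An $s$-extremal measure on $\mathbb{S}^d$ associated with $Q$ is a Borel probability measure $\mu$ on $\mathbb{S}^d$ that minimizes $\mathcal{I}_s[\mu]+2\int Q\,d\mu$ among all such measures. There is exactly one signed $s$-equilibrium $\eta_Q$ on $\mathbb{S}^d$ associated with $Q$, and $\eta_Q$ is a nonnegative measure if and only if (a) when $q>0$: $$\frac{W_s(\mathbb{S}^d)}{q}\ \ge\ \frac{(R+1)^{d-s}}{|R-1|^{d}}-U_s^{\sigma_d}(R);$$ (b) when $q<0$: $$\frac{W_s(\mathbb{S}^d)}{q}\ \le\ \frac{|R-1|^{d-s}}{(R+1)^{d}}-U_s^{\sigma_d}(R).$$ In this case the support of $\eta_Q$ is all of $\mathbb{S}^d$, and $\eta_Q$ is the unique $s$-extremal measure $\mu_Q$ on $\mathbb{S}^d$ associated with $Q$. -/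

import Mathlib

open MeasureTheory Set
open scoped ENNReal

noncomputable section

namespace Riesz

/-- The Riesz `s`-potential `U_s^μ(x) = ∫ |x - y|^{-s} dμ(y)` of a positive measure, with values
in `[0, ∞]` (for `s > 0` the kernel is `∞` on the diagonal). -/
def potential {p : ℕ} (s : ℝ) (μ : Measure (EuclideanSpace ℝ (Fin p)))
    (x : EuclideanSpace ℝ (Fin p)) : ℝ≥0∞ :=
  ∫⁻ y, edist x y ^ (-s) ∂μ

/-- The Riesz `s`-energy `I_s[μ] = ∫∫ |x - y|^{-s} dμ(y) dμ(x)`, with values in `[0, ∞]`. -/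
def energy {p : ℕ} (s : ℝ) (μ : Measure (EuclideanSpace ℝ (Fin p))) : ℝ≥0∞ :=
  ∫⁻ x, ∫⁻ y, edist x y ^ (-s) ∂μ ∂μ

/-- The class `M(A)` of Borel probability measures supported on the compact set `A`. -/
def unitMeasures {p : ℕ} (A : Set (EuclideanSpace ℝ (Fin p))) :
    Set (ProbabilityMeasure (EuclideanSpace ℝ (Fin p))) :=
  {μ | (μ : Measure (EuclideanSpace ℝ (Fin p))) Aᶜ = 0}

/-- The Riesz `s`-energy `W_s(A) = inf {I_s[μ] : μ ∈ M(A)}` of a compact set `A`. -/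
def minEnergy {p : ℕ} (s : ℝ) (A : Set (EuclideanSpace ℝ (Fin p))) : ℝ≥0∞ :=
  ⨅ μ ∈ unitMeasures A, energy s (μ : Measure (EuclideanSpace ℝ (Fin p)))

/-- The weighted energy `I_Q[μ] = I_s[μ] + 2 ∫ Q dμ` for an external field `Q` that is
continuous on the compact support of `μ`. It takes values in `(-∞, ∞]`. -/
def weightedEnergy {p : ℕ} (s : ℝ) (Q : EuclideanSpace ℝ (Fin p) → ℝ)
    (μ : Measure (EuclideanSpace ℝ (Fin p))) : EReal :=
  (energy s μ : EReal) + ((2 * ∫ x, Q x ∂μ : ℝ) : EReal)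

/-- The extremal value `V_Q(A) = inf {I_Q[μ] : μ ∈ M(A)}`. -/
def minWeightedEnergy {p : ℕ} (s : ℝ) (Q : EuclideanSpace ℝ (Fin p) → ℝ)
    (A : Set (EuclideanSpace ℝ (Fin p))) : EReal :=
  ⨅ μ ∈ unitMeasures A, weightedEnergy s Q (μ : Measure (EuclideanSpace ℝ (Fin p)))

/-- `μ` is an `s`-extremal measure on `A` associated with `Q`: it belongs to `M(A)` and
`I_Q[μ] = V_Q(A)`. -/
def IsExtremal {p : ℕ} (s : ℝ) (A : Set (EuclideanSpace ℝ (Fin p)))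
    (Q : EuclideanSpace ℝ (Fin p) → ℝ)
    (μ : ProbabilityMeasure (EuclideanSpace ℝ (Fin p))) : Prop :=
  μ ∈ unitMeasures A ∧
    weightedEnergy s Q (μ : Measure (EuclideanSpace ℝ (Fin p))) = minWeightedEnergy s Q A

/-- The Riesz `s`-potential of a signed measure `η`, as the difference of the potentials of the
two parts of its Jordan decomposition; meaningful where the potential of `|η|` is finite. -/
def signedPotential {p : ℕ} (s : ℝ) (η : SignedMeasure (EuclideanSpace ℝ (Fin p)))
    (x : EuclideanSpace ℝ (Fin p)) : ℝ :=
  (potential s η.toJordanDecomposition.posPart x).toReal -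
    (potential s η.toJordanDecomposition.negPart x).toReal

/-- `η` is a signed `s`-equilibrium on `A` associated with `Q`: a signed measure supported on `A`
with total charge `1` whose weighted Riesz `s`-potential exists and is constant everywhere
on `A`. -/
structure IsSignedEquilibrium {p : ℕ} (s : ℝ) (A : Set (EuclideanSpace ℝ (Fin p)))
    (Q : EuclideanSpace ℝ (Fin p) → ℝ)
    (η : SignedMeasure (EuclideanSpace ℝ (Fin p))) : Prop where
  supported : ∀ B, MeasurableSet B → Disjoint B A → η B = 0
  total_charge : η univ = 1
  potential_ne_top : ∀ x ∈ A, potential s η.totalVariation x ≠ ∞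
  const : ∃ G : ℝ, ∀ x ∈ A, signedPotential s η x + Q x = G

/-- The unit sphere `S^d` in `ℝ^{d+1}`. -/
abbrev unitSphere (d : ℕ) : Set (EuclideanSpace ℝ (Fin (d + 1))) :=
  Metric.sphere 0 1

/-- The normalized surface area measure `σ_d` on `S^d`, as a Borel measure on `ℝ^{d+1}`. -/
def sphereMeasure (d : ℕ) : Measure (EuclideanSpace ℝ (Fin (d + 1))) :=
  (((volume : Measure (EuclideanSpace ℝ (Fin (d + 1)))).toSphere univ)⁻¹ •
    (volume : Measure (EuclideanSpace ℝ (Fin (d + 1)))).toSphere).map Subtype.val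

/-- The point `a = (0, …, 0, R)` on the polar axis of `ℝ^{d+1}`. -/
def source (d : ℕ) (R : ℝ) : EuclideanSpace ℝ (Fin (d + 1)) :=
  EuclideanSpace.single (Fin.last d) R

/-- The Riesz external field `Q(x) = q / |x - a|^s` of a charge `q` at `a = (0, …, 0, R)`. -/
def field (d : ℕ) (s q R : ℝ) (x : EuclideanSpace ℝ (Fin (d + 1))) : ℝ :=
  q / dist x (source d R) ^ s

end Riesz

end

/-!
The signed equilibrium is explicit. Let `W` be the (constant) value on the sphere of the potential of
the surface measure `σ`, let `U` be its value at the source `a`, and let `κ` be the measure with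
density `k(y) = ||a|² - 1|^(d-s) / |y - a|^(2d-s)` with respect to `σ`. On the sphere the potential of
`κ` equals `W |x - a|^(-s)` (`lintegral_kernel_mul_kelvinDensity`), so
`η = ((W + q U) / W) σ - (q / W) κ` has weighted potential `W + q U` everywhere on the sphere, and its
total charge is `1` because `κ` has mass `U` (`lintegral_kelvinDensity`). The density of `η` is
monotone in `|y - a|`; hence `η ≥ 0` is a condition at one pole only, the one nearest to `a` if
`q > 0` and the one farthest from `a` if `q < 0`, where the density is explicit. Since the density can
vanish only at that pole, a nonnegative `η` has full support.

Potential of `κ`: the inversion about `a` that maps the sphere to itself acts at a point `y` of the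
sphere as the reflection along `y - a`, and its conformal factor is `||a|² - 1| / |y - a|²`. The change
of variables for `σ` follows from that for Lebesgue measure, applied to the positively homogeneous
extension of the inversion to the ball (`lintegral_comp_sphereInversion`), whose Jacobian is the
`d`-th power of the factor.

Energy: the Riesz kernel is a superposition of Gaussians, and a Gaussian is a superposition of
characters, so the kernel is strictly positive definite on measures of finite energy
(`two_mul_mutualEnergy_le`, `eq_of_two_mul_mutualEnergy_eq`). This gives `W_s(S^d) = W`
(`minEnergy_unitSphere`) and shows that a probability measure with constant weighted potential is the
unique minimizer (`isExtremal_iff_eq`).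

Uniqueness of the signed equilibrium: its definition does not provide finite energy, so positive
definiteness is not available. Instead, two positive measures with the same potential on the sphere
have, by integration against the measures `κ` for all sources `a`, the same potential off the sphere
(`lintegral_potential_mul_kelvinDensity`). Expanding that potential in powers of the position of the
source yields all moments `∫ ⟨x, w⟩ ^ n`, hence the characteristic function
(`eq_of_potential_off_sphere_eq`).
-/

noncomputable section

namespace Riesz

/-! ### Positive definiteness of the Gaussian kernel -/

section GaussianKernel

variable {E : Type*} [NormedAddCommGroup E] [InnerProductSpace ℝ E] [FiniteDimensional ℝ E]
  [MeasurableSpace E] [BorelSpace E]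

/-- Parseval's identity for a Gaussian and a finite measure. -/
lemma exists_integral_gaussian_eq_charFun {t : ℝ} (ht : 0 < t) :
    ∃ C : ℝ, 0 < C ∧ ∀ ρ : Measure E, IsFiniteMeasure ρ →
      ((∫ z, Real.exp (-t * ‖z‖ ^ 2) ∂ρ : ℝ) : ℂ) =
        C * ∫ v : E, (Real.exp (-(1 / (4 * t)) * ‖v‖ ^ 2) : ℂ) * charFun ρ v := by
  set b : ℝ := 1 / (4 * t) with hb
  have hb0 : 0 < b := by positivity
  have hbre : 0 < (b : ℂ).re := by simpa using hb0
  set D : ℝ := (Real.pi / b) ^ (Module.finrank ℝ E / 2 : ℝ) with hD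
  have hD0 : 0 < D := by positivity
  refine ⟨D⁻¹, by positivity, fun ρ _ ↦ ?_⟩
  have key : ∀ z : E, ∫ v : E, (Real.exp (-b * ‖v‖ ^ 2) : ℂ) * Complex.exp (inner ℝ z v * Complex.I)
      = D * (Real.exp (-t * ‖z‖ ^ 2) : ℂ) := by
    intro z
    have := GaussianFourier.integral_cexp_neg_mul_sq_norm_add hbre Complex.I z
    rw [show (Real.exp (-t * ‖z‖ ^ 2) : ℂ) = Complex.exp (Complex.I ^ 2 * ‖z‖ ^ 2 / (4 * b)) by
      push_cast
      congr 1
      rw [Complex.I_sq, hb]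
      have : (t : ℂ) ≠ 0 := by exact_mod_cast ht.ne'
      push_cast
      field_simp]
    rw [show (D : ℂ) = (Real.pi / b : ℂ) ^ (Module.finrank ℝ E / 2 : ℂ) by
      rw [hD, Complex.ofReal_cpow (by positivity)]; push_cast; rfl]
    rw [← this]
    congr 1 with v
    push_cast
    rw [← Complex.exp_add]
    ring_nf
  have hint : Integrable (fun v : E ↦ (Real.exp (-b * ‖v‖ ^ 2) : ℂ)) := by
    have := GaussianFourier.integrable_cexp_neg_mul_sq_norm_add hbre 0 (0 : E)
    refine this.congr (Filter.Eventually.of_forall fun v ↦ ?_)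
    simp
  have hswap : ∫ z, (∫ v : E, (Real.exp (-b * ‖v‖ ^ 2) : ℂ) *
      Complex.exp (inner ℝ z v * Complex.I)) ∂ρ =
      ∫ v : E, ∫ z, (Real.exp (-b * ‖v‖ ^ 2) : ℂ) * Complex.exp (inner ℝ z v * Complex.I) ∂ρ := by
    apply integral_integral_swap
    have h1 : Integrable (fun p : E × E ↦ (1 : ℂ) * (Real.exp (-b * ‖p.2‖ ^ 2) : ℂ))
        (ρ.prod volume) := Integrable.mul_prod (integrable_const (1 : ℂ)) hint
    refine h1.mono (by fun_prop) (Filter.Eventually.of_forall fun p ↦ ?_)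
    simp only [Function.uncurry, norm_mul, Complex.norm_exp_ofReal_mul_I, norm_one]
    linarith
  simp only [key, integral_const_mul] at hswap
  simp only [charFun_apply]
  rw [← hswap, ← integral_complex_ofReal]
  push_cast
  have : (D : ℂ) ≠ 0 := by exact_mod_cast hD0.ne'
  field_simp

/-- The mutual energy of two measures for the Gaussian kernel `exp (-t |x - y|²)`, written as an
integral over the distribution of the difference `x - y`. -/
def gaussEnergy (t : ℝ) (μ ν : Measure E) : ℝ :=
  ∫ z, Real.exp (-t * ‖z‖ ^ 2) ∂(μ ∗ ν.map (fun y ↦ -y))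

lemma two_mul_ofReal (r : ℝ) : 2 * ENNReal.ofReal r = ENNReal.ofReal (2 * r) := by
  rw [ENNReal.ofReal_mul (by norm_num), ENNReal.ofReal_ofNat]

lemma gaussEnergy_nonneg {E : Type*} [NormedAddCommGroup E] [MeasurableSpace E] (t : ℝ)
    (μ ν : Measure E) : 0 ≤ gaussEnergy t μ ν :=
  integral_nonneg fun _ ↦ (Real.exp_pos _).le

lemma integrable_gaussian {t : ℝ} (ht : 0 ≤ t) (ρ : Measure E) [IsFiniteMeasure ρ] :
    Integrable (fun z ↦ Real.exp (-t * ‖z‖ ^ 2)) ρ := by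
  refine (integrable_const (1 : ℝ)).mono (by fun_prop) (Filter.Eventually.of_forall fun z ↦ ?_)
  simp only [Real.norm_eq_abs, Real.abs_exp, abs_one, Real.exp_le_one_iff]
  nlinarith [sq_nonneg ‖z‖]

lemma ofReal_gaussEnergy {t : ℝ} (ht : 0 ≤ t) (μ ν : Measure E) [IsFiniteMeasure μ]
    [IsFiniteMeasure ν] :
    ENNReal.ofReal (gaussEnergy t μ ν) =
      ∫⁻ x, ∫⁻ y, ENNReal.ofReal (Real.exp (-t * dist x y ^ 2)) ∂ν ∂μ := by
  rw [gaussEnergy, ofReal_integral_eq_lintegral_ofReal (integrable_gaussian ht _)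
    (Filter.Eventually.of_forall fun z ↦ (Real.exp_pos _).le)]
  rw [Measure.lintegral_conv (by fun_prop)]
  refine lintegral_congr fun x ↦ ?_
  rw [lintegral_map (by fun_prop) (by fun_prop)]
  simp [dist_eq_norm, sub_eq_add_neg]

lemma charFun_conv_map_neg (μ ν : Measure E) [IsFiniteMeasure μ] [IsFiniteMeasure ν] (v : E) :
    charFun (μ ∗ ν.map (fun y ↦ -y)) v = charFun μ v * (starRingEnd ℂ) (charFun ν v) := by
  have h := charFun_map_smul (μ := ν) (-1) v
  simp only [neg_smul, one_smul, charFun_neg] at h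
  rw [charFun_conv, h]

/-- The Gaussian energy of `μ - ν` is a weighted square norm of the difference of the characteristic
functions. -/
lemma exists_gaussEnergy_sub_eq {t : ℝ} (ht : 0 < t) (μ ν : Measure E) [IsFiniteMeasure μ]
    [IsFiniteMeasure ν] :
    ∃ C : ℝ, 0 < C ∧ gaussEnergy t μ μ + gaussEnergy t ν ν - gaussEnergy t μ ν - gaussEnergy t ν μ =
      C * ∫ v : E, Real.exp (-(1 / (4 * t)) * ‖v‖ ^ 2) * ‖charFun μ v - charFun ν v‖ ^ 2 := by
  obtain ⟨C, hC, h⟩ := exists_integral_gaussian_eq_charFun (E := E) ht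
  refine ⟨C, hC, ?_⟩
  have hb : 0 < ((1 / (4 * t) : ℝ) : ℂ).re := by rw [Complex.ofReal_re]; positivity
  have hint : ∀ ρ : Measure E, IsFiniteMeasure ρ → Integrable
      (fun v : E ↦ (Real.exp (-(1 / (4 * t)) * ‖v‖ ^ 2) : ℂ) * charFun ρ v) := by
    intro ρ _
    have h0 : Integrable (fun v : E ↦ (Real.exp (-(1 / (4 * t)) * ‖v‖ ^ 2) : ℂ)) := by
      refine (GaussianFourier.integrable_cexp_neg_mul_sq_norm_add hb 0 (0 : E)).congr
        (Filter.Eventually.of_forall fun v ↦ ?_)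
      simp
    exact h0.mul_bdd (c := ρ.real univ) continuous_charFun.aestronglyMeasurable
      (Filter.Eventually.of_forall fun v ↦ norm_charFun_le v)
  apply Complex.ofReal_injective
  push_cast
  unfold gaussEnergy
  rw [h _ inferInstance, h _ inferInstance, h _ inferInstance, h _ inferInstance,
    ← integral_complex_ofReal, ← mul_add, ← mul_sub, ← mul_sub]
  rw [← integral_add, ← integral_sub, ← integral_sub]
  rotate_left
  · exact ((hint _ inferInstance).add (hint _ inferInstance)).sub (hint _ inferInstance)
  · exact hint _ inferInstance
  · exact (hint _ inferInstance).add (hint _ inferInstance)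
  · exact hint _ inferInstance
  · exact hint _ inferInstance
  · exact hint _ inferInstance
  congr 2 with v
  simp only [charFun_conv_map_neg]
  rw [Complex.ofReal_mul, Complex.ofReal_pow, ← Complex.mul_conj']
  simp only [map_sub]
  ring

lemma gaussEnergy_comm {t : ℝ} (ht : 0 ≤ t) (μ ν : Measure E) [IsFiniteMeasure μ]
    [IsFiniteMeasure ν] : gaussEnergy t μ ν = gaussEnergy t ν μ := by
  rw [← ENNReal.toReal_ofReal (gaussEnergy_nonneg t μ ν),
    ← ENNReal.toReal_ofReal (gaussEnergy_nonneg t ν μ),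
    ofReal_gaussEnergy ht, ofReal_gaussEnergy ht, lintegral_lintegral_swap (by fun_prop)]
  simp only [dist_comm]

/-- The Gaussian kernel is positive definite. -/
lemma two_mul_gaussEnergy_le {t : ℝ} (ht : 0 < t) (μ ν : Measure E) [IsFiniteMeasure μ]
    [IsFiniteMeasure ν] :
    2 * gaussEnergy t μ ν ≤ gaussEnergy t μ μ + gaussEnergy t ν ν := by
  obtain ⟨C, hC, h⟩ := exists_gaussEnergy_sub_eq ht μ ν
  rw [gaussEnergy_comm ht.le ν μ] at h
  have : 0 ≤ ∫ v : E, Real.exp (-(1 / (4 * t)) * ‖v‖ ^ 2) * ‖charFun μ v - charFun ν v‖ ^ 2 :=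
    integral_nonneg fun v ↦ by positivity
  nlinarith [mul_nonneg hC.le this]

/-- The Gaussian kernel is strictly positive definite: in the equality case the characteristic
functions agree almost everywhere, hence everywhere by continuity. -/
lemma eq_of_two_mul_gaussEnergy_eq {t : ℝ} (ht : 0 < t) (μ ν : Measure E) [IsFiniteMeasure μ]
    [IsFiniteMeasure ν] (heq : 2 * gaussEnergy t μ ν = gaussEnergy t μ μ + gaussEnergy t ν ν) :
    μ = ν := by
  obtain ⟨C, hC, h⟩ := exists_gaussEnergy_sub_eq ht μ ν
  rw [gaussEnergy_comm ht.le ν μ] at h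
  have h0 : ∫ v : E, Real.exp (-(1 / (4 * t)) * ‖v‖ ^ 2) * ‖charFun μ v - charFun ν v‖ ^ 2 = 0 := by
    have : C * ∫ v : E, Real.exp (-(1 / (4 * t)) * ‖v‖ ^ 2) *
        ‖charFun μ v - charFun ν v‖ ^ 2 = 0 := by
      linarith
    exact (mul_eq_zero.1 this).resolve_left hC.ne'
  have hcont : Continuous fun v : E ↦
      Real.exp (-(1 / (4 * t)) * ‖v‖ ^ 2) * ‖charFun μ v - charFun ν v‖ ^ 2 := by
    have h1 := continuous_charFun (μ := μ)
    have h2 := continuous_charFun (μ := ν)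
    fun_prop
  have hg : Integrable (fun v : E ↦ Real.exp (-(1 / (4 * t)) * ‖v‖ ^ 2)) := by
    have hb : 0 < ((1 / (4 * t) : ℝ) : ℂ).re := by rw [Complex.ofReal_re]; positivity
    have := (GaussianFourier.integrable_cexp_neg_mul_sq_norm_add hb 0 (0 : E)).re
    refine this.congr (Filter.Eventually.of_forall fun v ↦ ?_)
    simp only [zero_mul, add_zero]
    norm_cast
  have hint : Integrable (fun v : E ↦
      Real.exp (-(1 / (4 * t)) * ‖v‖ ^ 2) * ‖charFun μ v - charFun ν v‖ ^ 2) := by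
    have h1 := continuous_charFun (μ := μ)
    have h2 := continuous_charFun (μ := ν)
    refine hg.mul_bdd (c := (μ.real univ + ν.real univ) ^ 2)
      (Continuous.aestronglyMeasurable (by fun_prop)) (Filter.Eventually.of_forall fun v ↦ ?_)
    rw [norm_pow, norm_norm]
    gcongr
    exact (norm_sub_le _ _).trans (add_le_add (norm_charFun_le v) (norm_charFun_le v))
  rw [integral_eq_zero_iff_of_nonneg (fun v ↦ by positivity) hint] at h0
  have := Measure.eq_of_ae_eq h0 hcont continuous_zero
  refine Measure.ext_of_charFun (funext fun v ↦ ?_)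
  have hv := congrFun this v
  simpa [Real.exp_ne_zero, sub_eq_zero] using hv

end GaussianKernel

/-! ### Positive definiteness of the Riesz kernel -/

section RieszKernel

variable {p : ℕ}

/-- The Riesz kernel is a superposition of Gaussians; on the diagonal both sides are `∞`. -/
lemma exists_edist_rpow_eq_lintegral {s : ℝ} (hs : 0 < s) :
    ∃ c : ℝ≥0∞, c ≠ 0 ∧ c ≠ ∞ ∧ ∀ x y : EuclideanSpace ℝ (Fin p), edist x y ^ (-s) =
      c * ∫⁻ t in Ioi (0 : ℝ), ENNReal.ofReal (t ^ (s / 2 - 1)) *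
        ENNReal.ofReal (Real.exp (-t * dist x y ^ 2)) := by
  have hΓ : 0 < Real.Gamma (s / 2) := Real.Gamma_pos_of_pos (by positivity)
  refine ⟨ENNReal.ofReal (1 / Real.Gamma (s / 2)), by simpa using hΓ, by simp, fun x y ↦ ?_⟩
  rcases eq_or_ne x y with rfl | hxy
  · have : ∫⁻ t in Ioi (0 : ℝ), ENNReal.ofReal (t ^ (s / 2 - 1)) = ∞ := by
      by_contra hne
      refine not_integrableOn_Ioi_rpow (s / 2 - 1) ⟨?_, ?_⟩
      · exact (Measurable.pow_const measurable_id _).aestronglyMeasurable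
      · rw [hasFiniteIntegral_iff_ofReal]
        · exact lt_top_iff_ne_top.2 hne
        · filter_upwards [ae_restrict_mem measurableSet_Ioi] with t ht
          exact Real.rpow_nonneg (mem_Ioi.1 ht).le _
    simp [this, hs, hΓ, ENNReal.mul_top]
  · have hd : 0 < dist x y := dist_pos.2 hxy
    have h1 := Real.integral_rpow_mul_exp_neg_mul_Ioi (a := s / 2) (r := dist x y ^ 2)
      (by positivity) (by positivity)
    have hne : Integrable (fun t ↦ t ^ (s / 2 - 1) * Real.exp (-(dist x y ^ 2 * t)))
        (volume.restrict (Ioi (0 : ℝ))) := by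
      by_contra hni
      rw [integral_undef hni] at h1
      have : 0 < (1 / dist x y ^ 2) ^ (s / 2) * Real.Gamma (s / 2) := by positivity
      exact this.ne h1
    have h2 := ofReal_integral_eq_lintegral_ofReal hne (by
      filter_upwards [ae_restrict_mem measurableSet_Ioi] with t ht
      exact mul_nonneg (Real.rpow_nonneg (mem_Ioi.1 ht).le _) (Real.exp_pos _).le)
    have h3 : ∫⁻ t in Ioi (0 : ℝ), ENNReal.ofReal (t ^ (s / 2 - 1)) *
        ENNReal.ofReal (Real.exp (-t * dist x y ^ 2)) =
        ENNReal.ofReal ((1 / dist x y ^ 2) ^ (s / 2) * Real.Gamma (s / 2)) := by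
      rw [← h1, h2]
      refine setLIntegral_congr_fun measurableSet_Ioi fun t ht ↦ ?_
      rw [← ENNReal.ofReal_mul (Real.rpow_nonneg (mem_Ioi.1 ht).le _)]
      ring_nf
    rw [h3, edist_dist, ENNReal.ofReal_rpow_of_pos hd, ← ENNReal.ofReal_mul (by positivity)]
    congr 1
    have hpow : (1 / dist x y ^ 2) ^ (s / 2) = dist x y ^ (-s) := by
      rw [one_div, ← Real.rpow_natCast, Real.inv_rpow (by positivity), ← Real.rpow_mul hd.le,
        Real.rpow_neg hd.le]
      congr 2
      push_cast
      ring
    rw [hpow]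
    field_simp

/-- The mutual Riesz energy `∫ U_s^ν dμ` of two measures. -/
def mutualEnergy (s : ℝ) (μ ν : Measure (EuclideanSpace ℝ (Fin p))) : ℝ≥0∞ :=
  ∫⁻ x, potential s ν x ∂μ

lemma energy_eq_mutualEnergy (s : ℝ) (μ : Measure (EuclideanSpace ℝ (Fin p))) :
    energy s μ = mutualEnergy s μ μ := rfl

@[fun_prop]
lemma measurable_kernel (s : ℝ) : Measurable
    (fun z : EuclideanSpace ℝ (Fin p) × EuclideanSpace ℝ (Fin p) ↦ edist z.1 z.2 ^ (-s)) := by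
  fun_prop

lemma measurable_potential (s : ℝ) (μ : Measure (EuclideanSpace ℝ (Fin p))) [SFinite μ] :
    Measurable (potential s μ) :=
  (measurable_kernel s).lintegral_prod_right'

lemma mutualEnergy_comm (s : ℝ) (μ ν : Measure (EuclideanSpace ℝ (Fin p))) [SFinite μ]
    [SFinite ν] : mutualEnergy s μ ν = mutualEnergy s ν μ := by
  unfold mutualEnergy potential
  rw [lintegral_lintegral_swap (measurable_kernel s).aemeasurable]
  simp only [edist_comm]

/-- The mutual Riesz energy is a superposition of mutual Gaussian energies. -/
lemma exists_mutualEnergy_eq_lintegral {s : ℝ} (hs : 0 < s) :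
    ∃ c : ℝ≥0∞, c ≠ 0 ∧ c ≠ ∞ ∧ ∀ μ ν : Measure (EuclideanSpace ℝ (Fin p)),
      IsFiniteMeasure μ → IsFiniteMeasure ν → mutualEnergy s μ ν =
        c * ∫⁻ t in Ioi (0 : ℝ), ENNReal.ofReal (t ^ (s / 2 - 1)) *
          ENNReal.ofReal (gaussEnergy t μ ν) := by
  obtain ⟨c, hc0, hc, h⟩ := exists_edist_rpow_eq_lintegral (p := p) hs
  refine ⟨c, hc0, hc, fun μ ν _ _ ↦ ?_⟩
  have hm : Measurable (fun z : (EuclideanSpace ℝ (Fin p) × EuclideanSpace ℝ (Fin p)) × ℝ ↦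
      ENNReal.ofReal (z.2 ^ (s / 2 - 1)) *
        ENNReal.ofReal (Real.exp (-z.2 * dist z.1.1 z.1.2 ^ 2))) := by fun_prop
  have hm1 : ∀ x, Measurable (fun z : EuclideanSpace ℝ (Fin p) × ℝ ↦
      ENNReal.ofReal (z.2 ^ (s / 2 - 1)) *
        ENNReal.ofReal (Real.exp (-z.2 * dist x z.1 ^ 2))) := by intro x; fun_prop
  unfold mutualEnergy potential
  simp only [h]
  have e1 : ∀ x : EuclideanSpace ℝ (Fin p),
      ∫⁻ y, (c * ∫⁻ t in Ioi (0 : ℝ), ENNReal.ofReal (t ^ (s / 2 - 1)) *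
        ENNReal.ofReal (Real.exp (-t * dist x y ^ 2))) ∂ν =
      c * ∫⁻ t in Ioi (0 : ℝ), ENNReal.ofReal (t ^ (s / 2 - 1)) *
        ∫⁻ y, ENNReal.ofReal (Real.exp (-t * dist x y ^ 2)) ∂ν := by
    intro x
    rw [lintegral_const_mul' _ _ hc, lintegral_lintegral_swap (hm1 x).aemeasurable]
    congr 1
    refine lintegral_congr fun t ↦ ?_
    rw [lintegral_const_mul' _ _ (by simp)]
  simp only [e1]
  rw [lintegral_const_mul' _ _ hc, lintegral_lintegral_swap]
  · congr 1
    refine setLIntegral_congr_fun measurableSet_Ioi fun t ht ↦ ?_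
    rw [lintegral_const_mul' _ _ (by simp), ofReal_gaussEnergy (mem_Ioi.1 ht).le]
  · refine Measurable.aemeasurable ?_
    have : Measurable (fun z : (EuclideanSpace ℝ (Fin p) × ℝ) × EuclideanSpace ℝ (Fin p) ↦
      ENNReal.ofReal (Real.exp (-z.1.2 * dist z.1.1 z.2 ^ 2))) := by fun_prop
    have := this.lintegral_prod_right' (ν := ν)
    unfold Function.uncurry
    fun_prop

lemma measurable_gaussEnergy (μ ν : Measure (EuclideanSpace ℝ (Fin p))) [IsFiniteMeasure μ]
    [IsFiniteMeasure ν] : Measurable fun t ↦ gaussEnergy t μ ν := by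
  have : StronglyMeasurable (fun z : ℝ × EuclideanSpace ℝ (Fin p) ↦
      Real.exp (-z.1 * ‖z.2‖ ^ 2)) := by fun_prop
  exact (this.integral_prod_right' (ν := μ ∗ ν.map (fun y ↦ -y))).measurable

/-- The Riesz kernel is positive definite. -/
lemma two_mul_mutualEnergy_le {s : ℝ} (hs : 0 < s) (μ ν : Measure (EuclideanSpace ℝ (Fin p)))
    [IsFiniteMeasure μ] [IsFiniteMeasure ν] :
    2 * mutualEnergy s μ ν ≤ energy s μ + energy s ν := by
  obtain ⟨c, hc0, hc, h⟩ := exists_mutualEnergy_eq_lintegral (p := p) hs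
  simp only [energy_eq_mutualEnergy]
  rw [h _ _ inferInstance inferInstance, h _ _ inferInstance inferInstance,
    h _ _ inferInstance inferInstance, ← mul_add, mul_left_comm]
  have hmeas := measurable_gaussEnergy μ μ
  rw [← lintegral_add_left (by fun_prop), ← lintegral_const_mul' _ _ (by simp)]
  gcongr c * ?_
  refine setLIntegral_mono' measurableSet_Ioi fun t ht ↦ ?_
  rw [mul_left_comm, ← mul_add, ← ENNReal.ofReal_add (gaussEnergy_nonneg _ _ _)
    (gaussEnergy_nonneg _ _ _)]
  gcongr
  rw [two_mul_ofReal]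
  exact ENNReal.ofReal_le_ofReal (two_mul_gaussEnergy_le ht μ ν)

/-- The Riesz kernel is strictly positive definite on measures of finite energy. -/
lemma eq_of_two_mul_mutualEnergy_eq {s : ℝ} (hs : 0 < s)
    (μ ν : Measure (EuclideanSpace ℝ (Fin p))) [IsFiniteMeasure μ] [IsFiniteMeasure ν]
    (hfin : mutualEnergy s μ ν ≠ ∞)
    (heq : 2 * mutualEnergy s μ ν = energy s μ + energy s ν) : μ = ν := by
  obtain ⟨c, hc0, hc, h⟩ := exists_mutualEnergy_eq_lintegral (p := p) hs
  simp only [energy_eq_mutualEnergy] at heq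
  rw [h _ _ inferInstance inferInstance] at hfin
  rw [h _ _ inferInstance inferInstance, h _ _ inferInstance inferInstance,
    h _ _ inferInstance inferInstance, ← mul_add, mul_left_comm,
    ENNReal.mul_right_inj hc0 hc] at heq
  have hfin' : ∫⁻ t in Ioi (0 : ℝ), ENNReal.ofReal (t ^ (s / 2 - 1)) *
      ENNReal.ofReal (gaussEnergy t μ ν) ≠ ∞ := fun h ↦ hfin (by simp [h, hc0, ENNReal.mul_top])
  have hmeas := measurable_gaussEnergy μ μ
  have hmeas' := measurable_gaussEnergy μ ν
  have hmeas'' := measurable_gaussEnergy ν ν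
  rw [← lintegral_add_left (by fun_prop), ← lintegral_const_mul' _ _ (by simp)] at heq
  have hae := (ae_eq_of_ae_le_of_lintegral_le (μ := volume.restrict (Ioi (0 : ℝ)))
    (f := fun t ↦ 2 * (ENNReal.ofReal (t ^ (s / 2 - 1)) * ENNReal.ofReal (gaussEnergy t μ ν)))
    (g := fun t ↦ ENNReal.ofReal (t ^ (s / 2 - 1)) * ENNReal.ofReal (gaussEnergy t μ μ) +
      ENNReal.ofReal (t ^ (s / 2 - 1)) * ENNReal.ofReal (gaussEnergy t ν ν)) ?_ ?_ (by fun_prop)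
      heq.ge)
  · have : ∃ t ∈ Ioi (0 : ℝ),
        2 * (ENNReal.ofReal (t ^ (s / 2 - 1)) * ENNReal.ofReal (gaussEnergy t μ ν)) =
        ENNReal.ofReal (t ^ (s / 2 - 1)) * ENNReal.ofReal (gaussEnergy t μ μ) +
          ENNReal.ofReal (t ^ (s / 2 - 1)) * ENNReal.ofReal (gaussEnergy t ν ν) := by
      have hne : (ae (volume.restrict (Ioi (0 : ℝ)))).NeBot := by
        rw [ae_neBot, Ne, Measure.restrict_eq_zero]
        simp
      exact ((ae_restrict_mem measurableSet_Ioi).and hae).exists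
    obtain ⟨t, ht, h⟩ := this
    have ht : 0 < t := ht
    refine eq_of_two_mul_gaussEnergy_eq ht μ ν ?_
    have h0 := gaussEnergy_nonneg (E := EuclideanSpace ℝ (Fin p)) t
    rw [mul_left_comm, ← mul_add, ENNReal.mul_right_inj
      (by simpa using Real.rpow_pos_of_pos ht _) (by simp), ← ENNReal.ofReal_add (h0 _ _) (h0 _ _),
      two_mul_ofReal,
      ENNReal.ofReal_eq_ofReal_iff (by have := h0 μ ν; positivity)
        (add_nonneg (h0 _ _) (h0 _ _))] at h
    exact h
  · filter_upwards [ae_restrict_mem measurableSet_Ioi] with t ht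
    rw [mul_left_comm, ← mul_add, ← ENNReal.ofReal_add (gaussEnergy_nonneg _ _ _)
      (gaussEnergy_nonneg _ _ _)]
    gcongr
    rw [two_mul_ofReal]
    exact ENNReal.ofReal_le_ofReal (two_mul_gaussEnergy_le ht μ ν)
  · rw [lintegral_const_mul' _ _ (by simp)]
    exact ENNReal.mul_ne_top (by simp) hfin'

end RieszKernel

/-! ### The surface measure of the sphere -/

section SphereMeasure

variable {d : ℕ}

lemma volume_unitBall_ne_zero :
    (volume : Measure (EuclideanSpace ℝ (Fin (d + 1)))) (Metric.ball 0 1) ≠ 0 :=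
  (Metric.measure_ball_pos _ _ one_pos).ne'

lemma measurable_normalize :
    Measurable (fun y : EuclideanSpace ℝ (Fin (d + 1)) ↦ ‖y‖⁻¹ • y) :=
  measurable_norm.inv.smul measurable_id

lemma sphereMeasure_apply {U : Set (EuclideanSpace ℝ (Fin (d + 1)))} (hU : MeasurableSet U) :
    sphereMeasure d U = ((volume : Measure (EuclideanSpace ℝ (Fin (d + 1)))).toSphere univ)⁻¹ *
      (volume : Measure (EuclideanSpace ℝ (Fin (d + 1)))).toSphere (Subtype.val ⁻¹' U) := by
  rw [sphereMeasure, Measure.map_apply measurable_subtype_coe hU, Measure.smul_apply, smul_eq_mul]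

open scoped Pointwise in
/-- The normalized surface measure is the radial projection of the uniform measure on the unit
ball. -/
lemma sphereMeasure_eq_map : sphereMeasure d =
    (((volume : Measure (EuclideanSpace ℝ (Fin (d + 1)))) (Metric.ball 0 1))⁻¹ •
      ((volume : Measure (EuclideanSpace ℝ (Fin (d + 1)))).restrict (Metric.ball 0 1))).map
        (fun y ↦ ‖y‖⁻¹ • y) := by
  ext U hU
  have hset : Ioo (0 : ℝ) 1 • ((Subtype.val '' (Subtype.val ⁻¹' U :
      Set (Metric.sphere (0 : EuclideanSpace ℝ (Fin (d + 1))) 1))) :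
        Set (EuclideanSpace ℝ (Fin (d + 1)))) =
      ((fun y : EuclideanSpace ℝ (Fin (d + 1)) ↦ ‖y‖⁻¹ • y) ⁻¹' U ∩ Metric.ball 0 1) \ {0} := by
    ext y
    rw [Set.mem_smul]
    constructor
    · rintro ⟨r, hr, x, ⟨⟨x, hx⟩, hxU, rfl⟩, rfl⟩
      have hx1 : ‖x‖ = 1 := by simpa using hx
      have hr0 : r ≠ 0 := hr.1.ne'
      have hx0 : x ≠ 0 := by rintro rfl; simp at hx1
      simp only [mem_preimage] at hxU
      simp [norm_smul, hx1, abs_of_pos hr.1, hr0, hx0, hr.2, smul_smul, hxU]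
    · rintro ⟨⟨hyU, hy⟩, hy0⟩
      simp only [mem_singleton_iff] at hy0
      have hn : ‖y‖ ≠ 0 := norm_ne_zero_iff.2 hy0
      refine ⟨‖y‖, ⟨norm_pos_iff.2 hy0, by simpa using hy⟩, ‖y‖⁻¹ • y,
        ⟨⟨‖y‖⁻¹ • y, by simp [norm_smul, hn]⟩, hyU, rfl⟩, by simp [smul_smul, hn]⟩
  rw [sphereMeasure_apply hU, Measure.map_apply measurable_normalize hU, Measure.smul_apply,
    smul_eq_mul, Measure.restrict_apply (measurable_normalize hU),
    Measure.toSphere_apply' _ (measurable_subtype_coe hU), hset,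
    measure_sdiff_null (measure_singleton _), Measure.toSphere_apply_univ]
  have h1 : (Module.finrank ℝ (EuclideanSpace ℝ (Fin (d + 1))) : ℝ≥0∞) ≠ 0 := by simp
  rw [ENNReal.mul_inv (Or.inl h1) (Or.inl (by simp)), mul_mul_mul_comm,
    ENNReal.inv_mul_cancel h1 (by simp), one_mul]

lemma lintegral_sphereMeasure {h : EuclideanSpace ℝ (Fin (d + 1)) → ℝ≥0∞} (hh : Measurable h) :
    ∫⁻ x, h x ∂sphereMeasure d =
      ((volume : Measure (EuclideanSpace ℝ (Fin (d + 1)))) (Metric.ball 0 1))⁻¹ *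
        ∫⁻ y in Metric.ball (0 : EuclideanSpace ℝ (Fin (d + 1))) 1, h (‖y‖⁻¹ • y) := by
  rw [sphereMeasure_eq_map, lintegral_map hh measurable_normalize, lintegral_smul_measure,
    smul_eq_mul]

instance : IsProbabilityMeasure (sphereMeasure d) := by
  refine ⟨?_⟩
  rw [sphereMeasure_apply MeasurableSet.univ, preimage_univ]
  exact ENNReal.inv_mul_cancel (by simpa using volume_unitBall_ne_zero.symm.symm)
    (measure_ne_top _ _)

lemma sphereMeasure_compl_unitSphere : sphereMeasure d (unitSphere d)ᶜ = 0 := by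
  rw [sphereMeasure_apply Metric.isClosed_sphere.measurableSet.compl]
  have : (Subtype.val ⁻¹' (unitSphere d)ᶜ :
      Set (Metric.sphere (0 : EuclideanSpace ℝ (Fin (d + 1))) 1)) = ∅ := by
    ext x
    simp
  simp [this]

lemma ae_mem_unitSphere : ∀ᵐ x ∂sphereMeasure d, x ∈ unitSphere d :=
  sphereMeasure_compl_unitSphere

lemma sphereMeasure_pos_of_isOpen {U : Set (EuclideanSpace ℝ (Fin (d + 1)))} (hU : IsOpen U)
    (hne : (U ∩ unitSphere d).Nonempty) : 0 < sphereMeasure d U := by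
  rw [sphereMeasure_apply hU.measurableSet]
  obtain ⟨x, hxU, hx⟩ := hne
  refine ENNReal.mul_pos (by simp [ENNReal.mul_eq_top, measure_ball_lt_top.ne]) ?_
  exact (hU.preimage continuous_subtype_val).measure_ne_zero _ ⟨⟨x, hx⟩, hxU⟩

/-- The surface measure is invariant under linear isometries. -/
lemma lintegral_sphereMeasure_comp_isometry
    (L : EuclideanSpace ℝ (Fin (d + 1)) ≃ₗᵢ[ℝ] EuclideanSpace ℝ (Fin (d + 1)))
    {h : EuclideanSpace ℝ (Fin (d + 1)) → ℝ≥0∞} (hh : Measurable h) :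
    ∫⁻ x, h (L x) ∂sphereMeasure d = ∫⁻ x, h x ∂sphereMeasure d := by
  have hL : Measurable L := L.continuous.measurable
  rw [lintegral_sphereMeasure hh, lintegral_sphereMeasure (h := fun x ↦ h (L x)) (hh.comp hL),
    ← L.measurePreserving.setLIntegral_comp_preimage_emb
      L.toHomeomorph.measurableEmbedding (fun y ↦ h (‖y‖⁻¹ • y)) (Metric.ball 0 1)]
  have : L ⁻¹' Metric.ball 0 1 = Metric.ball 0 1 := by
    ext x; simp
  rw [this]
  simp

/-- The potential of the surface measure is constant on the sphere. -/
lemma potential_sphereMeasure_eq (s : ℝ) {x y : EuclideanSpace ℝ (Fin (d + 1))}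
    (hx : x ∈ unitSphere d) (hy : y ∈ unitSphere d) :
    potential s (sphereMeasure d) x = potential s (sphereMeasure d) y := by
  have hxy : ‖x‖ = ‖y‖ := by
    rw [mem_sphere_zero_iff_norm.1 hx, mem_sphere_zero_iff_norm.1 hy]
  set L := (Submodule.span ℝ {x - y})ᗮ.reflection with hL
  have hLx : L x = y := Submodule.reflection_sub hxy
  unfold potential
  rw [← lintegral_sphereMeasure_comp_isometry L (h := fun z ↦ edist y z ^ (-s)) (by fun_prop)]
  simp only [← hLx, L.edist_map]

lemma setLIntegral_enorm_rpow_ne_top {s : ℝ} (hs : s < d) (hs0 : 0 < s) :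
    ∫⁻ y in Metric.ball (0 : Fin d → ℝ) 2, ‖y‖ₑ ^ (-s) ≠ ∞ := by
  have hd : 0 < d := by
    have : (0 : ℝ) < d := hs0.trans hs
    exact_mod_cast this
  have : Nonempty (Fin d) := ⟨⟨0, hd⟩⟩
  have hint : IntegrableOn (fun y : Fin d → ℝ ↦ ‖y‖ ^ (-s)) (Metric.ball 0 2) := by
    rw [integrableOn_fun_norm_addHaar (f := fun r : ℝ ↦ r ^ (-s)) volume]
    have h1 : IntegrableOn (fun r : ℝ ↦ r ^ ((d : ℝ) - 1 - s)) (Ioo 0 2) := by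
      rw [← intervalIntegrable_iff_integrableOn_Ioo_of_le (by norm_num)]
      exact intervalIntegral.intervalIntegrable_rpow' (by linarith)
    refine h1.congr_fun (fun r hr ↦ ?_) measurableSet_Ioo
    simp only [Module.finrank_fintype_fun_eq_card, Fintype.card_fin, smul_eq_mul]
    rw [← Real.rpow_natCast, ← Real.rpow_add hr.1, Nat.cast_sub hd]
    push_cast
    ring_nf
  have h2 := hint.2
  rw [hasFiniteIntegral_iff_enorm] at h2
  refine (lt_of_eq_of_lt (lintegral_congr_ae ?_) h2).ne
  refine ae_restrict_of_ae ?_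
  have h0 : ∀ᵐ y : Fin d → ℝ, y ≠ 0 := by
    rw [ae_iff]
    simp
  filter_upwards [h0] with y hy
  have hy' : 0 < ‖y‖ := norm_pos_iff.2 hy
  rw [← ofReal_norm, ENNReal.ofReal_rpow_of_pos hy', Real.enorm_eq_ofReal (by positivity)]

/-- The potential of the surface measure is finite on the sphere exactly because `s` is less than
the dimension `d` of the sphere. -/
lemma potential_sphereMeasure_ne_top {s : ℝ} (hs0 : 0 < s) (hs : s < d)
    {x : EuclideanSpace ℝ (Fin (d + 1))} (hx : x ∈ unitSphere d) :
    potential s (sphereMeasure d) x ≠ ∞ := by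
  set e : EuclideanSpace ℝ (Fin (d + 1)) := EuclideanSpace.single (Fin.last d) 1 with he
  have heS : e ∈ unitSphere d := by simp [he]
  rw [potential_sphereMeasure_eq s hx heS, potential, lintegral_sphereMeasure (by fun_prop)]
  refine ENNReal.mul_ne_top (by simpa using volume_unitBall_ne_zero) ?_
  -- For `|y| < 1`, the distance from the direction `y / |y|` to the pole `e` is at least the sup
  -- norm of the coordinates of `y` orthogonal to `e`, so the last coordinate integrates out and a
  -- kernel of order `s < d` in `d` variables remains.
  have hle : ∀ y ∈ Metric.ball (0 : EuclideanSpace ℝ (Fin (d + 1))) 1,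
      edist e (‖y‖⁻¹ • y) ^ (-s) ≤ ‖fun i : Fin d ↦ y i.castSucc‖ₑ ^ (-s) := by
    intro y hy
    have hy1 : ‖y‖ < 1 := by simpa using hy
    rw [ENNReal.rpow_neg, ENNReal.rpow_neg, ENNReal.inv_le_inv]
    refine ENNReal.rpow_le_rpow ?_ hs0.le
    rw [edist_dist, ← ofReal_norm]
    refine ENNReal.ofReal_le_ofReal ((pi_norm_le_iff_of_nonneg dist_nonneg).2 fun i ↦ ?_)
    rcases eq_or_ne y 0 with rfl | hy0
    · simp
    have hn : 0 < ‖y‖ := norm_pos_iff.2 hy0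
    have h1 : ‖(e - ‖y‖⁻¹ • y) i.castSucc‖ ≤ ‖e - ‖y‖⁻¹ • y‖ := PiLp.norm_apply_le _ _
    have h2 : (e - ‖y‖⁻¹ • y) i.castSucc = -(‖y‖⁻¹ * y i.castSucc) := by
      simp [he, (Fin.castSucc_lt_last i).ne]
    rw [h2, norm_neg, norm_mul, norm_inv, norm_norm, ← dist_eq_norm] at h1
    refine le_trans ?_ h1
    rw [inv_mul_eq_div, le_div_iff₀ hn]
    nlinarith [norm_nonneg (y i.castSucc)]
  refine ne_top_of_le_ne_top ?_ (setLIntegral_mono' measurableSet_ball hle)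
  have hsub : Metric.ball (0 : EuclideanSpace ℝ (Fin (d + 1))) 1 ⊆
      WithLp.ofLp ⁻¹' ((MeasurableEquiv.piFinSuccAbove (fun _ ↦ ℝ) (Fin.last d)) ⁻¹'
        (Metric.ball (0 : ℝ) 2 ×ˢ Metric.ball (0 : Fin d → ℝ) 2)) := by
    intro y hy
    have hy1 : ‖y‖ < 1 := by simpa using hy
    have hc : ∀ i, ‖y i‖ < 2 := fun i ↦ (PiLp.norm_apply_le y i).trans_lt (by linarith)
    simp only [mem_preimage, mem_prod, mem_ball_zero_iff]
    refine ⟨hc _, (pi_norm_lt_iff (by norm_num)).2 fun i ↦ hc _⟩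
  refine ne_top_of_le_ne_top ?_ (lintegral_mono_set hsub)
  have hmp := (volume_preserving_piFinSuccAbove (fun _ : Fin (d + 1) ↦ ℝ) (Fin.last d)).comp
    (PiLp.volume_preserving_ofLp (Fin (d + 1)))
  have hmeas : Measurable (fun z : ℝ × (Fin d → ℝ) ↦ ‖z.2‖ₑ ^ (-s)) := by fun_prop
  have key := hmp.setLIntegral_comp_preimage
    (s := Metric.ball (0 : ℝ) 2 ×ˢ Metric.ball (0 : Fin d → ℝ) 2)
    (measurableSet_ball.prod measurableSet_ball) hmeas
  rw [preimage_comp] at key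
  have heq : ∀ y : EuclideanSpace ℝ (Fin (d + 1)), ‖fun i : Fin d ↦ y i.castSucc‖ₑ ^ (-s) =
      ‖((⇑(MeasurableEquiv.piFinSuccAbove (fun _ ↦ ℝ) (Fin.last d)) ∘ WithLp.ofLp) y).2‖ₑ ^ (-s) := by
    intro y
    congr 2
    ext i
    simp [MeasurableEquiv.piFinSuccAbove, Fin.init]
  simp only [heq]
  rw [key, Measure.volume_eq_prod, ← Measure.prod_restrict, lintegral_prod _ hmeas.aemeasurable]
  simp only [lintegral_const, Measure.restrict_apply MeasurableSet.univ, univ_inter]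
  exact ENNReal.mul_ne_top (setLIntegral_enorm_rpow_ne_top hs hs0) measure_ball_lt_top.ne

end SphereMeasure

/-! ### The inversion of the sphere about a point off the sphere -/

section SphereInversion

variable {d : ℕ}

open EuclideanGeometry

/-- The inversion of power `|a|² - 1` about `a`, which maps the unit sphere to itself. The power is
negative when `a` lies inside the sphere, so it is written as a dilation about `a` of Mathlib's
inversion of radius `1`. -/
def sphereInversion (a y : EuclideanSpace ℝ (Fin (d + 1))) : EuclideanSpace ℝ (Fin (d + 1)) :=
  a + (‖a‖ ^ 2 - 1) • (inversion a 1 y - a)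

/-- The signed conformal factor of `sphereInversion a` at `y`; it has the sign of `|a| - 1`. -/
def inversionScale (a y : EuclideanSpace ℝ (Fin (d + 1))) : ℝ :=
  (‖a‖ ^ 2 - 1) * (1 / dist y a) ^ 2

variable {a x y : EuclideanSpace ℝ (Fin (d + 1))}

lemma ne_of_mem_unitSphere (ha : ‖a‖ ≠ 1) (hy : ‖y‖ = 1) : y ≠ a := by
  rintro rfl; exact ha hy

lemma norm_sq_sub_one_ne_zero (ha : ‖a‖ ≠ 1) : ‖a‖ ^ 2 - 1 ≠ 0 := by
  intro h
  have : (‖a‖ - 1) * (‖a‖ + 1) = 0 := by linarith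
  rcases mul_eq_zero.1 this with h | h
  · exact ha (by linarith)
  · linarith [norm_nonneg a]

lemma inversionScale_ne_zero (ha : ‖a‖ ≠ 1) (hy : ‖y‖ = 1) : inversionScale a y ≠ 0 := by
  have := dist_pos.2 (ne_of_mem_unitSphere ha hy)
  exact mul_ne_zero (norm_sq_sub_one_ne_zero ha) (by positivity)

lemma sphereInversion_eq_add_smul :
    sphereInversion a y = a + inversionScale a y • (y - a) := by
  simp [sphereInversion, inversionScale, inversion, smul_smul]

/-- On the sphere, the inversion about `a` is the second intersection of the sphere with the line
through `a`, so it acts on the radius vector `y` as the reflection along `y - a`. -/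
lemma sphereInversion_eq_reflection (ha : ‖a‖ ≠ 1) (hy : ‖y‖ = 1) :
    sphereInversion a y = (Submodule.span ℝ {y - a})ᗮ.reflection y := by
  have hya := ne_of_mem_unitSphere ha hy
  have hD : ‖y - a‖ ≠ 0 := norm_ne_zero_iff.2 (sub_ne_zero.2 hya)
  have h1 : ‖y - a‖ ^ 2 = 1 - 2 * inner ℝ y a + ‖a‖ ^ 2 := by
    rw [norm_sub_sq_real, hy]; ring
  have h2 : inner ℝ (y - a) y = 1 - inner ℝ y a := by
    rw [inner_sub_left, real_inner_self_eq_norm_sq, hy, real_inner_comm]; ring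
  rw [Submodule.reflection_orthogonal_apply, Submodule.reflection_singleton_apply,
    sphereInversion_eq_add_smul, inversionScale, dist_eq_norm]
  have h3 : (‖a‖ ^ 2 - 1) * (1 / ‖y - a‖) ^ 2 =
      1 - 2 * (inner ℝ (y - a) y / ‖y - a‖ ^ 2) := by
    field_simp
    rw [h2, h1]
    ring
  rw [h3]
  simp only [RCLike.ofReal_real_eq_id, id]
  module

lemma norm_sphereInversion (ha : ‖a‖ ≠ 1) (hy : ‖y‖ = 1) : ‖sphereInversion a y‖ = 1 := by
  rw [sphereInversion_eq_reflection ha hy, LinearIsometryEquiv.norm_map, hy]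

lemma dist_sphereInversion (hx : x ≠ a) (hy : y ≠ a) :
    dist (sphereInversion a x) (sphereInversion a y) =
      |‖a‖ ^ 2 - 1| / (dist x a * dist y a) * dist x y := by
  have h := dist_inversion_inversion hx hy 1
  rw [sphereInversion, sphereInversion, dist_add_left, dist_eq_norm, ← smul_sub, norm_smul,
    sub_sub_sub_cancel_right, ← dist_eq_norm (inversion a 1 x), h, Real.norm_eq_abs]
  ring

lemma dist_sphereInversion_center :
    dist (sphereInversion a y) a = |‖a‖ ^ 2 - 1| / dist y a := by
  have h := dist_inversion_center a y 1
  rw [sphereInversion, dist_eq_norm, add_sub_cancel_left, norm_smul,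
    ← dist_eq_norm (inversion a 1 y), h,    Real.norm_eq_abs]
  ring

lemma sphereInversion_sphereInversion (ha : ‖a‖ ≠ 1) (hy : y ≠ a) :
    sphereInversion a (sphereInversion a y) = y := by
  have hk := norm_sq_sub_one_ne_zero ha
  have hD := dist_ne_zero.2 hy
  rw [sphereInversion_eq_add_smul, inversionScale, dist_sphereInversion_center,
    sphereInversion_eq_add_smul, add_sub_cancel_left, smul_smul, inversionScale]
  have : (‖a‖ ^ 2 - 1) * (1 / (|‖a‖ ^ 2 - 1| / dist y a)) ^ 2 *
      ((‖a‖ ^ 2 - 1) * (1 / dist y a) ^ 2) = 1 := by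
    rw [one_div_div, div_pow, sq_abs]
    field_simp
  rw [this, one_smul, add_sub_cancel]

lemma hasFDerivAt_sphereInversion (hy : y ≠ a) :
    HasFDerivAt (sphereInversion a) (inversionScale a y •
      ((Submodule.span ℝ {y - a})ᗮ.reflection :
        EuclideanSpace ℝ (Fin (d + 1)) →L[ℝ] EuclideanSpace ℝ (Fin (d + 1)))) y := by
  have h := ((hasFDerivAt_inversion (R := 1) hy).sub_const a).const_smul (‖a‖ ^ 2 - 1)
  rw [smul_smul] at h
  exact h.const_add a

/-- The positively homogeneous extension of `sphereInversion a` from the unit sphere. -/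
def coneInversion (a y : EuclideanSpace ℝ (Fin (d + 1))) : EuclideanSpace ℝ (Fin (d + 1)) :=
  ‖y‖ • sphereInversion a (‖y‖⁻¹ • y)

lemma norm_normalize (hy : y ≠ 0) : ‖‖y‖⁻¹ • y‖ = 1 := by
  simp [norm_smul, norm_ne_zero_iff.2 hy]

lemma norm_coneInversion (ha : ‖a‖ ≠ 1) (hy : y ≠ 0) : ‖coneInversion a y‖ = ‖y‖ := by
  rw [coneInversion, norm_smul, norm_sphereInversion ha (norm_normalize hy), norm_norm, mul_one]

lemma normalize_coneInversion (ha : ‖a‖ ≠ 1) (hy : y ≠ 0) :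
    ‖coneInversion a y‖⁻¹ • coneInversion a y = sphereInversion a (‖y‖⁻¹ • y) := by
  rw [norm_coneInversion ha hy, coneInversion, smul_smul,
    inv_mul_cancel₀ (norm_ne_zero_iff.2 hy), one_smul]

lemma coneInversion_coneInversion (ha : ‖a‖ ≠ 1) (hy : y ≠ 0) :
    coneInversion a (coneInversion a y) = y := by
  rw [coneInversion, normalize_coneInversion ha hy, sphereInversion_sphereInversion ha
    (ne_of_mem_unitSphere ha (norm_normalize hy)), norm_coneInversion ha hy, smul_smul,
    mul_inv_cancel₀ (norm_ne_zero_iff.2 hy), one_smul]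

/-- The derivative of `coneInversion a` on the ray through the unit vector `n`: it stretches `nᗮ`
by `inversionScale a n`, fixes `n`, and then reflects along `n - a`. -/
def coneInversionDeriv (a n : EuclideanSpace ℝ (Fin (d + 1))) :
    EuclideanSpace ℝ (Fin (d + 1)) →L[ℝ] EuclideanSpace ℝ (Fin (d + 1)) :=
  ((Submodule.span ℝ {n - a})ᗮ.reflection :
    EuclideanSpace ℝ (Fin (d + 1)) →L[ℝ] EuclideanSpace ℝ (Fin (d + 1))) ∘L
  (inversionScale a n • ContinuousLinearMap.id ℝ _ +
    (1 - inversionScale a n) • (innerSL ℝ n).smulRight n)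

lemma hasFDerivAt_coneInversion (ha : ‖a‖ ≠ 1) (hy : y ≠ 0) :
    HasFDerivAt (coneInversion a) (coneInversionDeriv a (‖y‖⁻¹ • y)) y := by
  have hr : ‖y‖ ≠ 0 := norm_ne_zero_iff.2 hy
  have hn := norm_normalize hy
  have hnorm : HasFDerivAt (fun z : EuclideanSpace ℝ (Fin (d + 1)) ↦ ‖z‖)
      (innerSL ℝ (‖y‖⁻¹ • y)) y := by
    have h := ((hasStrictFDerivAt_norm_sq y).hasFDerivAt).sqrt (by positivity)
    simp only [Real.sqrt_sq (norm_nonneg _)] at h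
    refine h.congr_fderiv ?_
    ext v
    simp
    field_simp
  have hinv := (hasDerivAt_inv hr).comp_hasFDerivAt y hnorm
  have hN : HasFDerivAt (fun z : EuclideanSpace ℝ (Fin (d + 1)) ↦ ‖z‖⁻¹ • z) _ y :=
    hinv.smul (hasFDerivAt_id (𝕜 := ℝ) y)
  have hJ : HasFDerivAt (fun z ↦ sphereInversion a (‖z‖⁻¹ • z)) _ y :=
    HasFDerivAt.comp (g := sphereInversion a) (f := fun z ↦ ‖z‖⁻¹ • z) y
      (hasFDerivAt_sphereInversion (ne_of_mem_unitSphere ha hn)) hN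
  have hF : HasFDerivAt (coneInversion a) _ y := hnorm.smul hJ
  refine hF.congr_fderiv ?_
  ext1 v
  set n := ‖y‖⁻¹ • y with hn_def
  have hyn : y = ‖y‖ • n := by rw [hn_def, smul_smul, mul_inv_cancel₀ hr, one_smul]
  rw [sphereInversion_eq_reflection ha hn]
  set ρ := (Submodule.span ℝ {n - a})ᗮ.reflection with hρ
  have hρy : ρ y = ‖y‖ • ρ n := by rw [← map_smul, ← hyn]
  simp only [coneInversionDeriv, ← hρ, add_apply,
    smul_apply, ContinuousLinearMap.comp_apply,
    ContinuousLinearMap.smulRight_apply, ContinuousLinearMap.id_apply, map_add, map_smul,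
    Function.comp_apply, innerSL_apply_apply, ContinuousLinearEquiv.coe_coe,
    LinearIsometryEquiv.coe_toContinuousLinearEquiv, hρy, smul_add, smul_smul]
  match_scalars
  · field_simp
  · simp
    field_simp
    ring

/-- The derivative is, up to a reflection, the factor `c` times the rank-one perturbation
`v ↦ v + ((1 - c) / c) ⟨n, v⟩ n` of the identity. -/
lemma abs_det_coneInversionDeriv {n : EuclideanSpace ℝ (Fin (d + 1))} (ha : ‖a‖ ≠ 1)
    (hn : ‖n‖ = 1) : |(coneInversionDeriv a n).det| = |inversionScale a n| ^ d := by
  have hc := inversionScale_ne_zero ha hn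
  set c := inversionScale a n with hc_def
  have h1 : ((c • ContinuousLinearMap.id ℝ _ + (1 - c) • (innerSL ℝ n).smulRight n :
      EuclideanSpace ℝ (Fin (d + 1)) →L[ℝ] EuclideanSpace ℝ (Fin (d + 1))) :
      EuclideanSpace ℝ (Fin (d + 1)) →ₗ[ℝ] EuclideanSpace ℝ (Fin (d + 1))) =
      c • LinearMap.transvection
        (((1 - c) / c) • (innerSL ℝ n : EuclideanSpace ℝ (Fin (d + 1)) →ₗ[ℝ] ℝ)) n := by
    ext1 v
    simp only [LinearMap.transvection, ContinuousLinearMap.coe_coe, LinearMap.smul_apply,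
      add_apply, smul_apply, LinearMap.coe_mk,
      AddHom.coe_mk, ContinuousLinearMap.smulRight_apply, ContinuousLinearMap.id_apply, smul_add,
      smul_smul, smul_eq_mul]
    congr 2
    field_simp
  have h2 := Submodule.det_reflection (Submodule.span ℝ {n - a})ᗮ
  have h3 : |LinearMap.det (((Submodule.span ℝ {n - a})ᗮ.reflection :
      EuclideanSpace ℝ (Fin (d + 1)) →L[ℝ] EuclideanSpace ℝ (Fin (d + 1))) :
        EuclideanSpace ℝ (Fin (d + 1)) →ₗ[ℝ] EuclideanSpace ℝ (Fin (d + 1)))| = 1 := by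
    refine Eq.trans (congrArg abs h2) ?_
    simp [abs_pow]
  rw [ContinuousLinearMap.det, coneInversionDeriv, ← hc_def,
    ContinuousLinearMap.toLinearMap_comp, LinearMap.det_comp, h1, LinearMap.det_smul,
    LinearMap.transvection.det, abs_mul, h3, one_mul, ← abs_pow]
  congr 1
  simp [hn]
  field_simp
  ring

end SphereInversion

/-! ### The Kelvin transform of the Riesz potential -/

section KelvinTransform

variable {d : ℕ} {a x y : EuclideanSpace ℝ (Fin (d + 1))}

open EuclideanGeometry

@[fun_prop]
lemma measurable_sphereInversion (a : EuclideanSpace ℝ (Fin (d + 1))) :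
    Measurable (sphereInversion a) := by
  have : sphereInversion a = fun y ↦ a + inversionScale a y • (y - a) :=
    funext fun y ↦ sphereInversion_eq_add_smul
  rw [this]
  unfold inversionScale
  fun_prop

/-- Change of variables for the inversion of the sphere about `a`. Radial projection turns both
sides into Lebesgue integrals over the ball, where the change of variables formula applies to the
homogeneous extension of the inversion. -/
lemma lintegral_comp_sphereInversion (ha : ‖a‖ ≠ 1)
    {h : EuclideanSpace ℝ (Fin (d + 1)) → ℝ≥0∞} (hh : Measurable h) :
    ∫⁻ y, ENNReal.ofReal (|inversionScale a y| ^ d) * h (sphereInversion a y) ∂sphereMeasure d =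
      ∫⁻ y, h y ∂sphereMeasure d := by
  have hmeas : Measurable fun y ↦
      ENNReal.ofReal (|inversionScale a y| ^ d) * h (sphereInversion a y) := by
    have : Measurable (inversionScale a) := by unfold inversionScale; fun_prop
    have h2 : Measurable fun y ↦ h (sphereInversion a y) :=
      hh.comp (measurable_sphereInversion a)
    have h3 : Measurable fun y ↦ |inversionScale a y| := this.norm
    fun_prop
  rw [lintegral_sphereMeasure hmeas, lintegral_sphereMeasure hh]
  congr 1
  -- the origin is removed because `coneInversion a` is not differentiable there
  set B : Set (EuclideanSpace ℝ (Fin (d + 1))) := Metric.ball 0 1 \ {0} with hB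
  have hBae : (Metric.ball 0 1 : Set (EuclideanSpace ℝ (Fin (d + 1)))) =ᵐ[volume] B :=
    (sdiff_null_ae_eq_self (measure_singleton _)).symm
  have hBmeas : MeasurableSet B := measurableSet_ball.diff (measurableSet_singleton _)
  have hmem : ∀ y ∈ B, y ≠ 0 := fun y hy ↦ hy.2
  have hmaps : ∀ y ∈ B, coneInversion a y ∈ B := by
    intro y hy
    have hn := norm_coneInversion ha (hmem y hy)
    refine ⟨by rw [mem_ball_zero_iff, hn]; simpa using hy.1, fun h0 ↦ hmem y hy ?_⟩
    rw [mem_singleton_iff.1 h0, norm_zero] at hn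
    exact norm_eq_zero.1 hn.symm
  have himg : coneInversion a '' B = B := by
    refine Subset.antisymm (image_subset_iff.2 hmaps) fun y hy ↦
      ⟨coneInversion a y, hmaps y hy, coneInversion_coneInversion ha (hmem y hy)⟩
  have hinj : InjOn (coneInversion a) B := fun y hy z hz hyz ↦ by
    rw [← coneInversion_coneInversion ha (hmem y hy), hyz,
      coneInversion_coneInversion ha (hmem z hz)]
  have hcv := lintegral_image_eq_lintegral_abs_det_fderiv_mul volume hBmeas
    (fun y hy ↦ (hasFDerivAt_coneInversion ha (hmem y hy)).hasFDerivWithinAt) hinj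
    (fun y ↦ h (‖y‖⁻¹ • y))
  rw [himg] at hcv
  rw [setLIntegral_congr hBae, setLIntegral_congr hBae, hcv]
  refine setLIntegral_congr_fun hBmeas fun y hy ↦ ?_
  simp only [normalize_coneInversion ha (hmem y hy),
    abs_det_coneInversionDeriv ha (norm_normalize (hmem y hy))]

/-- The density, with respect to the surface measure, of the measure on the sphere whose potential
is proportional to that of a point charge at `a`. -/
def kelvinDensity (d : ℕ) (s : ℝ) (a y : EuclideanSpace ℝ (Fin (d + 1))) : ℝ :=
  |‖a‖ ^ 2 - 1| ^ ((d : ℝ) - s) / dist y a ^ (2 * (d : ℝ) - s)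

lemma kelvinDensity_nonneg (s : ℝ) (a y : EuclideanSpace ℝ (Fin (d + 1))) :
    0 ≤ kelvinDensity d s a y := by
  unfold kelvinDensity; positivity

@[fun_prop]
lemma measurable_kelvinDensity (s : ℝ) (a : EuclideanSpace ℝ (Fin (d + 1))) :
    Measurable (kelvinDensity d s a) := by
  unfold kelvinDensity
  fun_prop

/-- Kelvin transform: the potential on the sphere of `kelvinDensity d s a` is that of a point charge
at `a` whose size is the potential of the surface measure on the sphere. -/
lemma lintegral_kernel_mul_kelvinDensity (s : ℝ) (ha : ‖a‖ ≠ 1) (hx : x ∈ unitSphere d) :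
    ∫⁻ y, edist x y ^ (-s) * ENNReal.ofReal (kelvinDensity d s a y) ∂sphereMeasure d =
      potential s (sphereMeasure d) x * edist x a ^ (-s) := by
  have hx1 : ‖x‖ = 1 := by simpa using hx
  have hxa := ne_of_mem_unitSphere ha hx1
  have hk : 0 < |‖a‖ ^ 2 - 1| := abs_pos.2 (norm_sq_sub_one_ne_zero ha)
  have hdx : 0 < dist x a := dist_pos.2 hxa
  have hJx : sphereInversion a x ∈ unitSphere d := by simp [norm_sphereInversion ha hx1]
  rw [potential_sphereMeasure_eq s hx hJx, potential,
    ← lintegral_comp_sphereInversion ha (h := fun z ↦ edist (sphereInversion a x) z ^ (-s))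
      (by fun_prop), mul_comm, edist_dist x a, ENNReal.ofReal_rpow_of_pos hdx,
    ← lintegral_const_mul' _ _ ENNReal.ofReal_ne_top]
  refine lintegral_congr_ae ?_
  filter_upwards [ae_mem_unitSphere] with y hy
  have hy1 : ‖y‖ = 1 := by simpa using hy
  have hya := ne_of_mem_unitSphere ha hy1
  have hdy : 0 < dist y a := dist_pos.2 hya
  have hscale : edist (sphereInversion a x) (sphereInversion a y) ^ (-s) =
      ENNReal.ofReal ((|‖a‖ ^ 2 - 1| / (dist x a * dist y a)) ^ (-s)) * edist x y ^ (-s) := by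
    have hpos : 0 < |‖a‖ ^ 2 - 1| / (dist x a * dist y a) := by positivity
    rw [edist_dist, dist_sphereInversion hxa hya, ENNReal.ofReal_mul (by positivity),
      ← edist_dist, ENNReal.mul_rpow_of_ne_top ENNReal.ofReal_ne_top (edist_ne_top _ _),
      ENNReal.ofReal_rpow_of_pos hpos]
  rw [hscale, ← mul_assoc, ← mul_assoc, mul_comm, ← ENNReal.ofReal_mul (by positivity),
    ← ENNReal.ofReal_mul (by positivity)]
  congr 2
  rw [kelvinDensity, inversionScale, abs_mul, abs_of_nonneg (sq_nonneg (1 / dist y a)), mul_pow,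
    ← pow_mul, one_div, inv_pow, Real.div_rpow (by positivity) (by positivity),
    Real.mul_rpow (by positivity) (by positivity), Real.rpow_sub hk, Real.rpow_sub hdy,
    Real.rpow_neg hdx.le, Real.rpow_neg hdy.le, Real.rpow_neg hk.le,
    Real.rpow_natCast, show (2 * (d : ℝ)) = ((2 * d : ℕ) : ℝ) by push_cast; ring,
    Real.rpow_natCast]
  field_simp

end KelvinTransform

/-! ### Unicity of Riesz potentials on the sphere -/

section Moments

variable {d : ℕ} {α β : Measure (EuclideanSpace ℝ (Fin (d + 1)))}

lemma abs_inner_le_of_mem_unitSphere {x : EuclideanSpace ℝ (Fin (d + 1))} (hx : x ∈ unitSphere d)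
    (w : EuclideanSpace ℝ (Fin (d + 1))) : |inner ℝ x w| ≤ ‖w‖ := by
  have h := abs_real_inner_le_norm x w
  rwa [mem_sphere_zero_iff_norm.1 hx, one_mul] at h

lemma potential_sphereMeasure_ne_zero {s : ℝ} (hs : 0 < s)
    (x : EuclideanSpace ℝ (Fin (d + 1))) : potential s (sphereMeasure d) x ≠ 0 := by
  intro h0
  rw [potential, lintegral_eq_zero_iff (by fun_prop)] at h0
  have hfalse : ∀ᵐ y ∂sphereMeasure d, False := by
    filter_upwards [h0] with y hy
    simp [hs, edist_ne_top, not_lt.2 hs.le] at hy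
  rw [ae_iff] at hfalse
  simp at hfalse

/-- A measure on the sphere is determined by its moments in all directions: they are the
coefficients of the power series of its characteristic function. -/
lemma eq_of_integral_inner_pow_eq [IsFiniteMeasure α] [IsFiniteMeasure β]
    (hα : ∀ᵐ x ∂α, x ∈ unitSphere d) (hβ : ∀ᵐ x ∂β, x ∈ unitSphere d)
    (h : ∀ (w : EuclideanSpace ℝ (Fin (d + 1))) (n : ℕ),
      ∫ x, inner ℝ x w ^ n ∂α = ∫ x, inner ℝ x w ^ n ∂β) : α = β := by
  refine Measure.ext_of_charFun (funext fun w ↦ ?_)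
  have key : ∀ μ : Measure (EuclideanSpace ℝ (Fin (d + 1))), IsFiniteMeasure μ →
      (∀ᵐ x ∂μ, x ∈ unitSphere d) →
      HasSum (fun n : ℕ ↦ (Complex.I ^ n / (n.factorial : ℂ)) * ((∫ x, inner ℝ x w ^ n ∂μ : ℝ) : ℂ))
        (charFun μ w) := by
    intro μ _ hμ
    have hb : ∀ n : ℕ, ∀ᵐ x ∂μ,
        ‖(Complex.I ^ n / (n.factorial : ℂ)) * ((inner ℝ x w ^ n : ℝ) : ℂ)‖ ≤
          ‖w‖ ^ n / n.factorial := by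
      intro n
      filter_upwards [hμ] with x hx
      have h1 := abs_inner_le_of_mem_unitSphere hx w
      simp only [norm_mul, norm_div, norm_pow, Complex.norm_I, one_pow, Complex.norm_natCast,
        Complex.norm_real, Real.norm_eq_abs]
      rw [div_mul_eq_mul_div, one_mul]
      gcongr
    have hint : ∀ n : ℕ, Integrable (fun x ↦
        (Complex.I ^ n / (n.factorial : ℂ)) * ((inner ℝ x w ^ n : ℝ) : ℂ)) μ := fun n ↦
      (integrable_const (‖w‖ ^ n / n.factorial : ℝ)).mono' (by fun_prop) (hb n)
    have hsum : Summable fun n : ℕ ↦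
        ∫ x, ‖(Complex.I ^ n / (n.factorial : ℂ)) * ((inner ℝ x w ^ n : ℝ) : ℂ)‖ ∂μ := by
      refine Summable.of_nonneg_of_le (fun n ↦ integral_nonneg fun x ↦ norm_nonneg _)
        (fun n ↦ ?_) ((Real.summable_pow_div_factorial ‖w‖).mul_left (μ.real univ))
      have := integral_mono_ae (hint n).norm (integrable_const _) (hb n)
      simpa using this
    have hs := hasSum_integral_of_summable_integral_norm hint hsum
    have hexp : charFun μ w =
        ∫ x, ∑' n : ℕ, (Complex.I ^ n / (n.factorial : ℂ)) * ((inner ℝ x w ^ n : ℝ) : ℂ) ∂μ := by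
      rw [charFun_apply]
      refine integral_congr_ae (Filter.Eventually.of_forall fun x ↦ ?_)
      simp only []
      rw [Complex.exp_eq_exp_ℂ, NormedSpace.exp_eq_tsum_div]
      refine tsum_congr fun n ↦ ?_
      push_cast
      rw [mul_pow]
      ring
    rw [hexp]
    simpa only [integral_const_mul, integral_complex_ofReal] using hs
  have h1 := key α inferInstance hα
  have h2 := key β inferInstance hβ
  simp only [h] at h1
  exact h1.unique h2

/-- Differentiation under the integral sign in the generating function of the moments. The bound
`‖w‖ ≤ 1 / 2` keeps `1 - t ⟨x, w⟩` at least `1 / 2` on the sphere for all `|t| < 1`. -/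
lemma hasDerivAt_integral_inner_pow_mul [IsFiniteMeasure α] (hα : ∀ᵐ x ∂α, x ∈ unitSphere d)
    {r : ℝ} (hr : 0 < r) (n : ℕ) {w : EuclideanSpace ℝ (Fin (d + 1))} (hw : ‖w‖ ≤ 1 / 2)
    {t : ℝ} (ht : t ∈ Ioo (-1 : ℝ) 1) :
    HasDerivAt (fun t ↦ ∫ x, inner ℝ x w ^ n * (1 - t * inner ℝ x w) ^ (-r) ∂α)
      (r * ∫ x, inner ℝ x w ^ (n + 1) * (1 - t * inner ℝ x w) ^ (-r - 1) ∂α) t := by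
  have hhalf : ∀ x ∈ unitSphere d, |inner ℝ x w| ≤ 1 / 2 := fun x hx ↦
    (abs_inner_le_of_mem_unitSphere hx w).trans hw
  have hpos : ∀ x ∈ unitSphere d, ∀ t ∈ Ioo (-1 : ℝ) 1, 1 / 2 ≤ 1 - t * inner ℝ x w := by
    intro x hx t ht
    have h1 := hhalf x hx
    have h2 : |t| ≤ 1 := abs_le.2 ⟨ht.1.le, ht.2.le⟩
    have h3 : t * inner ℝ x w ≤ |t| * |inner ℝ x w| := by
      rw [← abs_mul]; exact le_abs_self _
    nlinarith [abs_nonneg t, abs_nonneg (inner ℝ x w)]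
  have hbound : ∀ x ∈ unitSphere d, ∀ t ∈ Ioo (-1 : ℝ) 1, ∀ (m : ℕ) (q : ℝ), 0 < q →
      ‖inner ℝ x w ^ m * (1 - t * inner ℝ x w) ^ (-q)‖ ≤ 1 * (1 / 2 : ℝ) ^ (-q) := by
    intro x hx t ht m q hq
    have h0 := hpos x hx t ht
    rw [norm_mul, norm_pow, Real.norm_eq_abs, Real.norm_eq_abs,
      abs_of_nonneg (Real.rpow_nonneg (by linarith) _)]
    gcongr ?_ * ?_
    · exact pow_le_one₀ (abs_nonneg _) ((hhalf x hx).trans (by norm_num))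
    · exact Real.rpow_le_rpow_of_nonpos (by norm_num) h0 (by linarith)
  have hmeas : ∀ (m : ℕ) (q t : ℝ), AEStronglyMeasurable
      (fun x ↦ inner ℝ x w ^ m * (1 - t * inner ℝ x w) ^ (-q)) α := by
    intro m q t
    refine Measurable.aestronglyMeasurable ?_
    have : Measurable fun x : EuclideanSpace ℝ (Fin (d + 1)) ↦ (inner ℝ x w : ℝ) := by fun_prop
    fun_prop
  have hmain := hasDerivAt_integral_of_dominated_loc_of_deriv_le (μ := α)
    (F := fun t x ↦ inner ℝ x w ^ n * (1 - t * inner ℝ x w) ^ (-r))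
    (F' := fun t x ↦ r * (inner ℝ x w ^ (n + 1) * (1 - t * inner ℝ x w) ^ (-r - 1)))
    (bound := fun _ ↦ r * (1 * (1 / 2 : ℝ) ^ (-(r + 1)))) (x₀ := t) (s := Ioo (-1) 1)
    (Ioo_mem_nhds ht.1 ht.2)
    (Filter.Eventually.of_forall fun t ↦ hmeas n r t) ?_ ?_ ?_ (integrable_const _) ?_
  · have h := hmain.2
    rwa [integral_const_mul] at h
  · refine (integrable_const (1 * (1 / 2 : ℝ) ^ (-r))).mono' (hmeas n r t) ?_
    filter_upwards [hα] with x hx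
    exact hbound x hx t ht n r hr
  · have := hmeas (n + 1) (r + 1) t
    rw [neg_add'] at this
    exact this.const_mul r
  · filter_upwards [hα] with x hx t ht
    rw [norm_mul, Real.norm_of_nonneg hr.le]
    have := hbound x hx t ht (n + 1) (r + 1) (by linarith)
    rw [neg_add'] at this ⊢
    gcongr
  · filter_upwards [hα] with x hx t ht
    have h0 := hpos x hx t ht
    have h1 : HasDerivAt (fun t : ℝ ↦ 1 - t * inner ℝ x w) (-inner ℝ x w) t := by
      simpa using ((hasDerivAt_id t).mul_const (inner ℝ x w)).const_sub 1
    have h2 := (h1.rpow_const (p := -r) (Or.inl (by linarith))).const_mul (inner ℝ x w ^ n)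
    refine h2.congr_deriv ?_
    ring

/-- A measure on the sphere is determined by its Riesz potential off the sphere: expanding the
potential around the origin yields all moments. -/
lemma eq_of_potential_off_sphere_eq [IsFiniteMeasure α] [IsFiniteMeasure β]
    (hα : ∀ᵐ x ∂α, x ∈ unitSphere d) (hβ : ∀ᵐ x ∂β, x ∈ unitSphere d) {s : ℝ} (hs : 0 < s)
    (h : ∀ a : EuclideanSpace ℝ (Fin (d + 1)), ‖a‖ ≠ 1 →
      ∫⁻ x, edist x a ^ (-s) ∂α = ∫⁻ x, edist x a ^ (-s) ∂β) : α = β := by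
  -- The source `a = c v` with `c = 1 / (1 + √(1 - |v|²))` has `|x - a|² = 2c (1 - ⟨x, v⟩)` on the
  -- sphere.
  have h0 : ∀ v : EuclideanSpace ℝ (Fin (d + 1)), ‖v‖ < 1 →
      ∫ x, (1 - inner ℝ x v) ^ (-(s / 2)) ∂α = ∫ x, (1 - inner ℝ x v) ^ (-(s / 2)) ∂β := by
    intro v hv
    set q := √(1 - ‖v‖ ^ 2) with hq_def
    have hv2 : 0 < 1 - ‖v‖ ^ 2 := by nlinarith [norm_nonneg v]
    have hq : 0 < q := Real.sqrt_pos.2 hv2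
    have hqv : q ^ 2 = 1 - ‖v‖ ^ 2 := Real.sq_sqrt hv2.le
    set c := 1 / (1 + q) with hc_def
    have hc : 0 < c := by positivity
    have hc1 : c < 1 := by rw [hc_def, div_lt_one (by positivity)]; linarith
    have ha : ‖c • v‖ ≠ 1 := by
      rw [norm_smul, Real.norm_of_nonneg hc.le]
      nlinarith [norm_nonneg v]
    have hdist : ∀ x ∈ unitSphere d, dist x (c • v) ^ 2 = 2 * c * (1 - inner ℝ x v) := by
      intro x hx
      rw [dist_eq_norm, norm_sub_sq_real, mem_sphere_zero_iff_norm.1 hx, inner_smul_right,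
        norm_smul, Real.norm_of_nonneg hc.le, mul_pow, show ‖v‖ ^ 2 = 1 - q ^ 2 by linarith, hc_def]
      field_simp
      ring
    have key : ∀ μ : Measure (EuclideanSpace ℝ (Fin (d + 1))), IsFiniteMeasure μ →
        (∀ᵐ x ∂μ, x ∈ unitSphere d) →
        ∫ x, (1 - inner ℝ x v) ^ (-(s / 2)) ∂μ =
          (2 * c) ^ (s / 2) * (∫⁻ x, edist x (c • v) ^ (-s) ∂μ).toReal := by
      intro μ _ hμ
      have hker : ∀ᵐ x ∂μ, edist x (c • v) ^ (-s) =
          ENNReal.ofReal ((2 * c) ^ (-(s / 2)) * (1 - inner ℝ x v) ^ (-(s / 2))) := by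
        filter_upwards [hμ] with x hx
        have hd : 0 < dist x (c • v) := dist_pos.2
          (ne_of_mem_unitSphere ha (mem_sphere_zero_iff_norm.1 hx))
        have h1 : 0 < 1 - inner ℝ x v := by
          have := abs_inner_le_of_mem_unitSphere hx v
          linarith [le_abs_self (inner ℝ x v)]
        rw [edist_dist, ENNReal.ofReal_rpow_of_pos hd, ← Real.mul_rpow (by positivity) h1.le,
          ← hdist x hx, ← Real.rpow_natCast, ← Real.rpow_mul hd.le]
        congr 2
        push_cast
        ring
      rw [lintegral_congr_ae hker, ← integral_eq_lintegral_of_nonneg_ae, integral_const_mul,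
        ← mul_assoc, ← Real.rpow_add (by positivity), add_neg_cancel, Real.rpow_zero, one_mul]
      · filter_upwards [hμ] with x hx
        have h1 : 0 < 1 - inner ℝ x v := by
          have := abs_inner_le_of_mem_unitSphere hx v
          linarith [le_abs_self (inner ℝ x v)]
        positivity
      · refine Measurable.aestronglyMeasurable ?_
        have : Measurable fun x : EuclideanSpace ℝ (Fin (d + 1)) ↦ (inner ℝ x v : ℝ) := by fun_prop
        fun_prop
    rw [key α inferInstance hα, key β inferInstance hβ, h _ ha]
  have h1 : ∀ w : EuclideanSpace ℝ (Fin (d + 1)), ‖w‖ ≤ 1 / 2 → ∀ n : ℕ, ∀ t ∈ Ioo (-1 : ℝ) 1,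
      ∫ x, inner ℝ x w ^ n * (1 - t * inner ℝ x w) ^ (-(s / 2 + n)) ∂α =
        ∫ x, inner ℝ x w ^ n * (1 - t * inner ℝ x w) ^ (-(s / 2 + n)) ∂β := by
    intro w hw n
    induction n with
    | zero =>
      intro t ht
      have h2 : |t| < 1 := abs_lt.2 ⟨ht.1, ht.2⟩
      have := h0 (t • w) (by
        rw [norm_smul, Real.norm_eq_abs]
        nlinarith [abs_nonneg t, norm_nonneg w])
      simpa [inner_smul_right] using this
    | succ n ih =>
      intro t ht
      have hr : 0 < s / 2 + n := by positivity
      have e1 := hasDerivAt_integral_inner_pow_mul hα hr n hw ht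
      have e2 := hasDerivAt_integral_inner_pow_mul hβ hr n hw ht
      have e3 := e1.unique (e2.congr_of_eventuallyEq
        (Filter.eventuallyEq_of_mem (Ioo_mem_nhds ht.1 ht.2) ih))
      have e4 := mul_left_cancel₀ hr.ne' e3
      rw [show -(s / 2 + n) - 1 = -(s / 2 + ((n + 1 : ℕ) : ℝ)) by push_cast; ring] at e4
      exact e4
  -- at `t = 0` these are the moments, in directions of norm at most `1 / 2`; rescale
  refine eq_of_integral_inner_pow_eq hα hβ fun w n ↦ ?_
  rcases eq_or_ne w 0 with rfl | hw
  · have := h1 0 (by simp) n 0 (by simp)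
    simpa using this
  have hw' : ‖w‖ ≠ 0 := norm_ne_zero_iff.2 hw
  have h2 := h1 ((2 * ‖w‖)⁻¹ • w) (by
    rw [norm_smul, norm_inv, norm_mul, norm_norm]
    field_simp
    simp) n 0 (by simp)
  simp only [inner_smul_right, mul_pow, zero_mul, sub_zero, Real.one_rpow, mul_one] at h2
  rw [integral_const_mul, integral_const_mul] at h2
  exact mul_left_cancel₀ (by positivity) h2

/-- The Kelvin transform recovers the potential of `α` at a point `a` off the sphere from the
potential on the sphere. -/
lemma lintegral_potential_mul_kelvinDensity [IsFiniteMeasure α] (hα : ∀ᵐ x ∂α, x ∈ unitSphere d)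
    {s : ℝ} {a e : EuclideanSpace ℝ (Fin (d + 1))} (ha : ‖a‖ ≠ 1) (he : e ∈ unitSphere d)
    (hfin : potential s (sphereMeasure d) e ≠ ∞) :
    ∫⁻ y, potential s α y * ENNReal.ofReal (kelvinDensity d s a y) ∂sphereMeasure d =
      potential s (sphereMeasure d) e * ∫⁻ x, edist x a ^ (-s) ∂α := by
  rw [← lintegral_const_mul' _ _ hfin]
  have e1 : ∀ᵐ x ∂α, potential s (sphereMeasure d) e * edist x a ^ (-s) =
      ∫⁻ y, edist x y ^ (-s) * ENNReal.ofReal (kelvinDensity d s a y) ∂sphereMeasure d := by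
    filter_upwards [hα] with x hx
    rw [lintegral_kernel_mul_kelvinDensity s ha hx, potential_sphereMeasure_eq s hx he]
  rw [lintegral_congr_ae e1, lintegral_lintegral_swap]
  · refine lintegral_congr fun y ↦ ?_
    rw [lintegral_mul_const' _ _ ENNReal.ofReal_ne_top, potential]
    simp only [edist_comm]
  · unfold Function.uncurry
    fun_prop

/-- A measure on the sphere is determined by its Riesz potential on the sphere, without any
assumption of finite energy: the potential on the sphere determines the potential off the sphere. -/
lemma eq_of_potential_eq [IsFiniteMeasure α] [IsFiniteMeasure β]
    (hα : ∀ᵐ x ∂α, x ∈ unitSphere d) (hβ : ∀ᵐ x ∂β, x ∈ unitSphere d) {s : ℝ} (hs : 0 < s)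
    (hsd : s < d) (h : ∀ x ∈ unitSphere d, potential s α x = potential s β x) : α = β := by
  obtain ⟨e, he⟩ : (unitSphere d).Nonempty := NormedSpace.sphere_nonempty.2 zero_le_one
  have hfin := potential_sphereMeasure_ne_top hs hsd he
  refine eq_of_potential_off_sphere_eq hα hβ hs fun a ha ↦ ?_
  refine (ENNReal.mul_right_inj (potential_sphereMeasure_ne_zero hs e) hfin).1 ?_
  rw [← lintegral_potential_mul_kelvinDensity hα ha he hfin,
    ← lintegral_potential_mul_kelvinDensity hβ ha he hfin]
  refine lintegral_congr_ae ?_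
  filter_upwards [ae_mem_unitSphere] with y hy
  rw [h y hy]

end Moments

/-! ### Potentials of signed measures -/

section SignedPotential

variable {p : ℕ} {s : ℝ}

lemma potential_add (s : ℝ) (μ ν : Measure (EuclideanSpace ℝ (Fin p)))
    (x : EuclideanSpace ℝ (Fin p)) : potential s (μ + ν) x = potential s μ x + potential s ν x :=
  lintegral_add_measure _ _ _

lemma potential_mono {μ ν : Measure (EuclideanSpace ℝ (Fin p))} (h : μ ≤ ν)
    (x : EuclideanSpace ℝ (Fin p)) : potential s μ x ≤ potential s ν x :=
  lintegral_mono' h le_rfl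

/-- Comparison of the Jordan decomposition with another decomposition, without subtraction. -/
lemma posPart_add_eq_negPart_add {η : SignedMeasure (EuclideanSpace ℝ (Fin p))}
    {μ₁ μ₂ : Measure (EuclideanSpace ℝ (Fin p))} [IsFiniteMeasure μ₁] [IsFiniteMeasure μ₂]
    (h : η = μ₁.toSignedMeasure - μ₂.toSignedMeasure) :
    η.toJordanDecomposition.posPart + μ₂ = η.toJordanDecomposition.negPart + μ₁ := by
  have hη := η.toSignedMeasure_toJordanDecomposition
  rw [JordanDecomposition.toSignedMeasure, sub_eq_iff_eq_add] at hη
  rw [← Measure.toSignedMeasure_eq_toSignedMeasure_iff, Measure.toSignedMeasure_add,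
    Measure.toSignedMeasure_add, hη]
  nth_rw 1 [h]
  abel

/-- The Jordan decomposition is the smallest decomposition into positive measures. -/
lemma posPart_le_and_negPart_le {η : SignedMeasure (EuclideanSpace ℝ (Fin p))}
    {μ₁ μ₂ : Measure (EuclideanSpace ℝ (Fin p))} [IsFiniteMeasure μ₁] [IsFiniteMeasure μ₂]
    (h : η = μ₁.toSignedMeasure - μ₂.toSignedMeasure) :
    η.toJordanDecomposition.posPart ≤ μ₁ ∧ η.toJordanDecomposition.negPart ≤ μ₂ := by
  have hadd := posPart_add_eq_negPart_add h
  have aux : ∀ α β α' β' : Measure (EuclideanSpace ℝ (Fin p)), α.MutuallySingular β →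
      α + β' = β + α' → α ≤ α' := by
    intro α β α' β' ⟨T, hT, hα, hβ⟩ heq
    refine Measure.le_iff.2 fun B hB ↦ ?_
    calc α B = α (B ∩ Tᶜ) := (measure_inter_conull' (measure_mono_null (by
            rintro x ⟨-, hx⟩; simpa using hx) hα)).symm
      _ ≤ (α + β') (B ∩ Tᶜ) := le_self_add
      _ = (β + α') (B ∩ Tᶜ) := by rw [heq]
      _ = α' (B ∩ Tᶜ) := by
          rw [Measure.add_apply, measure_mono_null inter_subset_right hβ, zero_add]
      _ ≤ α' B := measure_mono inter_subset_left
  exact ⟨aux _ _ _ _ η.toJordanDecomposition.mutuallySingular hadd,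
    aux _ _ _ _ η.toJordanDecomposition.mutuallySingular.symm hadd.symm⟩

lemma potential_totalVariation_ne_top {η : SignedMeasure (EuclideanSpace ℝ (Fin p))}
    {μ₁ μ₂ : Measure (EuclideanSpace ℝ (Fin p))} [IsFiniteMeasure μ₁] [IsFiniteMeasure μ₂]
    (h : η = μ₁.toSignedMeasure - μ₂.toSignedMeasure) {x : EuclideanSpace ℝ (Fin p)}
    (h₁ : potential s μ₁ x ≠ ∞) (h₂ : potential s μ₂ x ≠ ∞) :
    potential s η.totalVariation x ≠ ∞ := by
  obtain ⟨hp, hn⟩ := posPart_le_and_negPart_le h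
  rw [SignedMeasure.totalVariation, potential_add]
  exact ENNReal.add_ne_top.2 ⟨ne_top_of_le_ne_top h₁ (potential_mono hp x),
    ne_top_of_le_ne_top h₂ (potential_mono hn x)⟩

lemma signedPotential_eq_sub {η : SignedMeasure (EuclideanSpace ℝ (Fin p))}
    {μ₁ μ₂ : Measure (EuclideanSpace ℝ (Fin p))} [IsFiniteMeasure μ₁] [IsFiniteMeasure μ₂]
    (h : η = μ₁.toSignedMeasure - μ₂.toSignedMeasure) {x : EuclideanSpace ℝ (Fin p)}
    (h₁ : potential s μ₁ x ≠ ∞) (h₂ : potential s μ₂ x ≠ ∞) :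
    signedPotential s η x = (potential s μ₁ x).toReal - (potential s μ₂ x).toReal := by
  obtain ⟨hp, hn⟩ := posPart_le_and_negPart_le h
  have hp' := ne_top_of_le_ne_top h₁ (potential_mono (s := s) hp x)
  have hn' := ne_top_of_le_ne_top h₂ (potential_mono (s := s) hn x)
  have hadd := congrArg (fun μ ↦ (potential s μ x).toReal) (posPart_add_eq_negPart_add h)
  simp only [potential_add, ENNReal.toReal_add hp' h₂, ENNReal.toReal_add hn' h₁] at hadd
  rw [signedPotential]
  linarith

/-- The Jordan parts of a signed measure supported on `A` are supported on `A`. -/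
lemma posPart_negPart_compl_eq_zero {η : SignedMeasure (EuclideanSpace ℝ (Fin p))}
    {A : Set (EuclideanSpace ℝ (Fin p))} (hA : MeasurableSet A)
    (h : ∀ B, MeasurableSet B → Disjoint B A → η B = 0) :
    η.toJordanDecomposition.posPart Aᶜ = 0 ∧ η.toJordanDecomposition.negPart Aᶜ = 0 := by
  obtain ⟨i, hi, hi₀, hi₁, hp, hn⟩ := η.toJordanDecomposition_spec
  have hz : ∀ j, MeasurableSet j → η (j ∩ Aᶜ) = 0 := fun j hj ↦
    h _ (hj.inter hA.compl) (disjoint_compl_left.mono_left inter_subset_right)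
  rw [hp, hn, SignedMeasure.toMeasureOfZeroLE_apply _ hi₀ hi hA.compl,
    SignedMeasure.toMeasureOfLEZero_apply _ hi₁ hi.compl hA.compl]
  simp only [hz _ hi, hz _ hi.compl]
  exact ⟨by norm_cast, by simp⟩

end SignedPotential

/-! ### Extremal measures from constant weighted potentials -/

section Extremal

variable {p : ℕ} {s : ℝ}

/-- A probability measure whose weighted potential is constant on `A` is the unique extremal
measure, by strict positive definiteness of the Riesz kernel. -/
lemma isExtremal_iff_eq (hs : 0 < s) {A : Set (EuclideanSpace ℝ (Fin p))}
    {Q : EuclideanSpace ℝ (Fin p) → ℝ} (hQ : Measurable Q) {C : ℝ} (hQC : ∀ x ∈ A, |Q x| ≤ C)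
    {μ : ProbabilityMeasure (EuclideanSpace ℝ (Fin p))} (hμA : μ ∈ unitMeasures A) {G : ℝ}
    (hfin : ∀ x ∈ A, potential s μ x ≠ ∞)
    (hG : ∀ x ∈ A, (potential s μ x).toReal + Q x = G)
    (ν : ProbabilityMeasure (EuclideanSpace ℝ (Fin p))) :
    IsExtremal s A Q ν ↔ ν = μ := by
  have hQint : ∀ ν ∈ unitMeasures A, Integrable Q (ν : Measure (EuclideanSpace ℝ (Fin p))) := by
    intro ν hν
    refine (integrable_const C).mono' hQ.aestronglyMeasurable ?_
    have : ∀ᵐ x ∂(ν : Measure (EuclideanSpace ℝ (Fin p))), x ∈ A := hν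
    filter_upwards [this] with x hx using hQC x hx
  have hmut : ∀ ν ∈ unitMeasures A,
      mutualEnergy s (ν : Measure (EuclideanSpace ℝ (Fin p))) μ ≠ ∞ ∧
      (mutualEnergy s (ν : Measure (EuclideanSpace ℝ (Fin p))) μ).toReal = G - ∫ x, Q x ∂ν := by
    intro ν hν
    have hae : ∀ᵐ x ∂(ν : Measure (EuclideanSpace ℝ (Fin p))), x ∈ A := hν
    have hnn : 0 ≤ᵐ[(ν : Measure (EuclideanSpace ℝ (Fin p)))] fun x ↦ G - Q x := by
      filter_upwards [hae] with x hx
      rw [← hG x hx]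
      simp
    have hint : Integrable (fun x ↦ G - Q x) (ν : Measure (EuclideanSpace ℝ (Fin p))) :=
      (integrable_const G).sub (hQint ν hν)
    have heq : mutualEnergy s (ν : Measure (EuclideanSpace ℝ (Fin p))) μ =
        ENNReal.ofReal (∫ x, (G - Q x) ∂ν) := by
      rw [ofReal_integral_eq_lintegral_ofReal hint hnn]
      refine lintegral_congr_ae ?_
      filter_upwards [hae] with x hx
      rw [← hG x hx, add_sub_cancel_right, ENNReal.ofReal_toReal (hfin x hx)]
    refine ⟨heq ▸ ENNReal.ofReal_ne_top, ?_⟩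
    rw [heq, ENNReal.toReal_ofReal (integral_nonneg_of_ae hnn),
      integral_sub (integrable_const G) (hQint ν hν)]
    simp
  obtain ⟨hμtop, hμreal⟩ := hmut μ hμA
  rw [← energy_eq_mutualEnergy] at hμreal hμtop
  -- `I_Q[ν] - I_Q[μ] = I[ν] + I[μ] - 2 I[ν, μ]` when `ν` has finite energy
  have hwμ : weightedEnergy s Q (μ : Measure (EuclideanSpace ℝ (Fin p))) =
      (((energy s (μ : Measure (EuclideanSpace ℝ (Fin p)))).toReal + 2 * ∫ x, Q x ∂μ : ℝ) :
        EReal) := by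
    rw [weightedEnergy, EReal.coe_add, EReal.coe_ennreal_toReal hμtop]
  have hwν : ∀ ν : ProbabilityMeasure (EuclideanSpace ℝ (Fin p)),
      energy s (ν : Measure (EuclideanSpace ℝ (Fin p))) ≠ ∞ →
      weightedEnergy s Q (ν : Measure (EuclideanSpace ℝ (Fin p))) =
      (((energy s (ν : Measure (EuclideanSpace ℝ (Fin p)))).toReal + 2 * ∫ x, Q x ∂ν : ℝ) :
        EReal) := by
    intro ν hν
    rw [weightedEnergy, EReal.coe_add, EReal.coe_ennreal_toReal hν]
  have htop : ∀ ν : ProbabilityMeasure (EuclideanSpace ℝ (Fin p)),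
      energy s (ν : Measure (EuclideanSpace ℝ (Fin p))) = ∞ →
      weightedEnergy s Q (ν : Measure (EuclideanSpace ℝ (Fin p))) = ⊤ := by
    intro ν hν
    rw [weightedEnergy, hν, EReal.coe_ennreal_top, EReal.top_add_coe]
  have hle : ∀ ν ∈ unitMeasures A,
      weightedEnergy s Q (μ : Measure (EuclideanSpace ℝ (Fin p))) ≤
        weightedEnergy s Q (ν : Measure (EuclideanSpace ℝ (Fin p))) := by
    intro ν hν
    by_cases hν' : energy s (ν : Measure (EuclideanSpace ℝ (Fin p))) = ∞
    · rw [htop ν hν']; exact le_top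
    rw [hwμ, hwν ν hν', EReal.coe_le_coe_iff]
    obtain ⟨hνtop, hνreal⟩ := hmut ν hν
    have h := ENNReal.toReal_mono (ENNReal.add_ne_top.2 ⟨hν', hμtop⟩)
      (two_mul_mutualEnergy_le hs (ν : Measure (EuclideanSpace ℝ (Fin p))) μ)
    rw [ENNReal.toReal_mul, hνreal, ENNReal.toReal_add hν' hμtop] at h
    simp only [ENNReal.toReal_ofNat] at h
    linarith
  have hmin : minWeightedEnergy s Q A =
      weightedEnergy s Q (μ : Measure (EuclideanSpace ℝ (Fin p))) :=
    le_antisymm (iInf₂_le μ hμA) (le_iInf₂ hle)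
  constructor
  · rintro ⟨hν, heq⟩
    rw [hmin] at heq
    have hν' : energy s (ν : Measure (EuclideanSpace ℝ (Fin p))) ≠ ∞ := by
      intro h
      rw [htop ν h, hwμ] at heq
      exact EReal.coe_ne_top _ heq.symm
    rw [hwμ, hwν ν hν', EReal.coe_eq_coe_iff] at heq
    obtain ⟨hνtop, hνreal⟩ := hmut ν hν
    apply Subtype.ext
    refine eq_of_two_mul_mutualEnergy_eq hs (ν : Measure (EuclideanSpace ℝ (Fin p)))
      (μ : Measure (EuclideanSpace ℝ (Fin p))) hνtop ?_
    rw [← ENNReal.toReal_eq_toReal_iff' (ENNReal.mul_ne_top (by simp) hνtop)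
      (ENNReal.add_ne_top.2 ⟨hν', hμtop⟩), ENNReal.toReal_mul, hνreal,
      ENNReal.toReal_add hν' hμtop]
    simp only [ENNReal.toReal_ofNat]
    linarith
  · rintro rfl
    exact ⟨hμA, hmin.symm⟩

end Extremal

/-! ### Equal potentials up to a constant, and the minimal energy -/

section Equilibrium

variable {d : ℕ} {s : ℝ} {a e : EuclideanSpace ℝ (Fin (d + 1))}

lemma lintegral_potential_sphereMeasure {α : Measure (EuclideanSpace ℝ (Fin (d + 1)))}
    [IsFiniteMeasure α] (hα : ∀ᵐ x ∂α, x ∈ unitSphere d) (he : e ∈ unitSphere d) :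
    ∫⁻ x, potential s α x ∂sphereMeasure d = potential s (sphereMeasure d) e * α univ := by
  have h := mutualEnergy_comm s (sphereMeasure d) α
  unfold mutualEnergy at h
  rw [h, ← lintegral_const]
  refine lintegral_congr_ae ?_
  filter_upwards [hα] with x hx
  exact potential_sphereMeasure_eq s hx he

/-- Measures on the sphere of equal mass whose potentials differ by a constant are equal:
integrating against the surface measure shows that the constant is zero. -/
lemma eq_of_potential_sub_eq_const (hs : 0 < s) (hsd : s < d)
    {α β : Measure (EuclideanSpace ℝ (Fin (d + 1)))} [IsFiniteMeasure α] [IsFiniteMeasure β]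
    (hα : ∀ᵐ x ∂α, x ∈ unitSphere d) (hβ : ∀ᵐ x ∂β, x ∈ unitSphere d)
    (hmass : α univ = β univ) (hα' : ∀ x ∈ unitSphere d, potential s α x ≠ ∞)
    (hβ' : ∀ x ∈ unitSphere d, potential s β x ≠ ∞) {c : ℝ}
    (hc : ∀ x ∈ unitSphere d, (potential s α x).toReal - (potential s β x).toReal = c) :
    α = β := by
  wlog hc0 : 0 ≤ c generalizing α β c
  · exact (this hβ hα hmass.symm hβ' hα' (c := -c) (fun x hx ↦ by rw [← hc x hx]; ring)
      (by linarith)).symm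
  obtain ⟨e, he⟩ : (unitSphere d).Nonempty := NormedSpace.sphere_nonempty.2 zero_le_one
  have hpt : ∀ x ∈ unitSphere d, potential s α x = potential s β x + ENNReal.ofReal c := by
    intro x hx
    rw [← ENNReal.toReal_eq_toReal_iff' (hα' x hx) (ENNReal.add_ne_top.2 ⟨hβ' x hx, by simp⟩),
      ENNReal.toReal_add (hβ' x hx) (by simp), ENNReal.toReal_ofReal hc0]
    linarith [hc x hx]
  have hint : ∫⁻ x, potential s α x ∂sphereMeasure d =
      ∫⁻ x, potential s β x ∂sphereMeasure d + ENNReal.ofReal c := by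
    rw [lintegral_congr_ae (ae_mem_unitSphere.mono hpt),
      lintegral_add_left (measurable_potential s β)]
    simp
  rw [lintegral_potential_sphereMeasure hα he, lintegral_potential_sphereMeasure hβ he,
    hmass] at hint
  have hfin : potential s (sphereMeasure d) e * β univ ≠ ∞ :=
    ENNReal.mul_ne_top (potential_sphereMeasure_ne_top hs hsd he) (measure_ne_top _ _)
  have hc1 : ENNReal.ofReal c = 0 := by
    have : potential s (sphereMeasure d) e * β univ + 0 =
        potential s (sphereMeasure d) e * β univ + ENNReal.ofReal c := by rwa [add_zero]
    exact ((ENNReal.add_right_inj hfin).1 this).symm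
  refine eq_of_potential_eq hα hβ hs hsd fun x hx ↦ ?_
  rw [hpt x hx, hc1, add_zero]

/-- The surface measure has minimal energy: its potential is constant on the sphere, so positive
definiteness bounds the energy of any other probability measure from below. -/
lemma minEnergy_unitSphere (hs : 0 < s) (hsd : s < d) (he : e ∈ unitSphere d) :
    minEnergy s (unitSphere d) = potential s (sphereMeasure d) e := by
  have hconst : ∀ μ : Measure (EuclideanSpace ℝ (Fin (d + 1))), IsProbabilityMeasure μ →
      (∀ᵐ x ∂μ, x ∈ unitSphere d) →
      mutualEnergy s μ (sphereMeasure d) = potential s (sphereMeasure d) e := by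
    intro μ _ hμ
    rw [mutualEnergy, lintegral_congr_ae
      (hμ.mono fun x hx ↦ potential_sphereMeasure_eq s hx he), lintegral_const, measure_univ,
      mul_one]
  have hfin := potential_sphereMeasure_ne_top hs hsd he
  have hσ : energy s (sphereMeasure d) = potential s (sphereMeasure d) e :=
    hconst _ inferInstance ae_mem_unitSphere
  refine le_antisymm ?_ (le_iInf₂ fun μ hμ ↦ ?_)
  · exact (iInf₂_le (⟨sphereMeasure d, inferInstance⟩ :
      ProbabilityMeasure (EuclideanSpace ℝ (Fin (d + 1)))) sphereMeasure_compl_unitSphere).trans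
        hσ.le
  · have h := two_mul_mutualEnergy_le hs (μ : Measure (EuclideanSpace ℝ (Fin (d + 1))))
      (sphereMeasure d)
    rw [hconst μ inferInstance hμ, hσ, two_mul] at h
    exact (ENNReal.add_le_add_iff_right hfin).1 h

/-- The surface measure has no atoms, as an atom would make the potential infinite. -/
lemma sphereMeasure_singleton (hs : 0 < s) (hsd : s < d) (he : e ∈ unitSphere d) :
    sphereMeasure d {e} = 0 := by
  by_contra h0
  refine potential_sphereMeasure_ne_top hs hsd he (top_le_iff.1 ?_)
  calc ∞ = ∫⁻ y in {e}, edist e y ^ (-s) ∂sphereMeasure d := by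
        rw [lintegral_singleton, edist_self, ENNReal.zero_rpow_of_neg (by linarith),
          ENNReal.top_mul h0]
    _ ≤ potential s (sphereMeasure d) e := setLIntegral_le_lintegral _ _

/-! ### The Kelvin measure -/

/-- The total mass of the Kelvin density is the potential of the surface measure at `a`, because
integrating the potential of the Kelvin measure against the surface measure gives both, up to the
same factor. -/
lemma lintegral_kelvinDensity (hs : 0 < s) (hsd : s < d) (ha : ‖a‖ ≠ 1) :
    ∫⁻ y, ENNReal.ofReal (kelvinDensity d s a y) ∂sphereMeasure d =
      potential s (sphereMeasure d) a := by
  obtain ⟨e, he⟩ : (unitSphere d).Nonempty := NormedSpace.sphere_nonempty.2 zero_le_one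
  have hfin := potential_sphereMeasure_ne_top hs hsd he
  have h := lintegral_potential_mul_kelvinDensity (α := sphereMeasure d) ae_mem_unitSphere ha he hfin
  rw [lintegral_congr_ae (ae_mem_unitSphere.mono fun y hy ↦ by
    rw [potential_sphereMeasure_eq s hy he]), lintegral_const_mul' _ _ hfin,
    ENNReal.mul_right_inj (potential_sphereMeasure_ne_zero hs e) hfin] at h
  rw [h, potential]
  simp only [edist_comm]

lemma potential_sphereMeasure_ne_top_of_norm_ne_one (hs : 0 < s) (ha : ‖a‖ ≠ 1) :
    potential s (sphereMeasure d) a ≠ ∞ := by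
  have hpos : 0 < |‖a‖ - 1| := abs_pos.2 (sub_ne_zero.2 ha)
  have hle : ∀ y ∈ unitSphere d, edist a y ^ (-s) ≤ ENNReal.ofReal (|‖a‖ - 1| ^ (-s)) := by
    intro y hy
    have h1 : |‖a‖ - 1| ≤ dist a y := by
      rw [dist_eq_norm, ← mem_sphere_zero_iff_norm.1 hy]
      exact abs_norm_sub_norm_le a y
    rw [edist_dist, ENNReal.ofReal_rpow_of_pos (hpos.trans_le h1)]
    exact ENNReal.ofReal_le_ofReal (Real.rpow_le_rpow_of_nonpos hpos h1 (by linarith))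
  refine ne_top_of_le_ne_top ?_ (lintegral_mono_ae (ae_mem_unitSphere.mono hle))
  simp

/-- The measure on the sphere with density `kelvinDensity d s a`. -/
def kelvinMeasure (d : ℕ) (s : ℝ) (a : EuclideanSpace ℝ (Fin (d + 1))) :
    Measure (EuclideanSpace ℝ (Fin (d + 1))) :=
  (sphereMeasure d).withDensity fun y ↦ ENNReal.ofReal (kelvinDensity d s a y)

lemma isFiniteMeasure_kelvinMeasure (hs : 0 < s) (hsd : s < d) (ha : ‖a‖ ≠ 1) :
    IsFiniteMeasure (kelvinMeasure d s a) :=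
  isFiniteMeasure_withDensity (by
    rw [lintegral_kelvinDensity hs hsd ha]
    exact potential_sphereMeasure_ne_top_of_norm_ne_one hs ha)

lemma potential_kelvinMeasure (ha : ‖a‖ ≠ 1) {x : EuclideanSpace ℝ (Fin (d + 1))}
    (hx : x ∈ unitSphere d) : potential s (kelvinMeasure d s a) x =
      potential s (sphereMeasure d) x * edist x a ^ (-s) := by
  rw [← lintegral_kernel_mul_kelvinDensity s ha hx, potential, kelvinMeasure,
    lintegral_withDensity_eq_lintegral_mul _ (by fun_prop) (by fun_prop)]
  simp only [Pi.mul_apply, mul_comm]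

lemma integrable_kelvinDensity (hs : 0 < s) (hsd : s < d) (ha : ‖a‖ ≠ 1) :
    Integrable (kelvinDensity d s a) (sphereMeasure d) := by
  refine ⟨(measurable_kelvinDensity s a).aestronglyMeasurable, ?_⟩
  rw [hasFiniteIntegral_iff_ofReal
    (Filter.Eventually.of_forall fun y ↦ kelvinDensity_nonneg s a y),
    lintegral_kelvinDensity hs hsd ha]
  exact lt_top_iff_ne_top.2 (potential_sphereMeasure_ne_top_of_norm_ne_one hs ha)

lemma integral_kelvinDensity (hs : 0 < s) (hsd : s < d) (ha : ‖a‖ ≠ 1) :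
    ∫ y, kelvinDensity d s a y ∂sphereMeasure d = (potential s (sphereMeasure d) a).toReal := by
  rw [integral_eq_lintegral_of_nonneg_ae
    (Filter.Eventually.of_forall fun y ↦ kelvinDensity_nonneg s a y)
    (measurable_kelvinDensity s a).aestronglyMeasurable, lintegral_kelvinDensity hs hsd ha]

lemma kelvinMeasure_real (s : ℝ) (a : EuclideanSpace ℝ (Fin (d + 1)))
    {B : Set (EuclideanSpace ℝ (Fin (d + 1)))} (hB : MeasurableSet B) :
    (kelvinMeasure d s a).real B = ∫ y in B, kelvinDensity d s a y ∂sphereMeasure d := by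
  rw [integral_eq_lintegral_of_nonneg_ae
    (Filter.Eventually.of_forall fun y ↦ kelvinDensity_nonneg s a y)
    (measurable_kelvinDensity s a).aestronglyMeasurable, Measure.real, kelvinMeasure,
    withDensity_apply _ hB]

lemma potential_nnreal_smul (s : ℝ) (c : NNReal) (μ : Measure (EuclideanSpace ℝ (Fin (d + 1))))
    (x : EuclideanSpace ℝ (Fin (d + 1))) : potential s (c • μ) x = c * potential s μ x := by
  rw [potential, lintegral_smul_measure]
  rfl

/-- The signed measure with density `A - B * kelvinDensity d s a`, as a difference of two positive
measures with finite potentials on the sphere. -/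
lemma exists_sub_eq_kelvin (hs : 0 < s) (hsd : s < d) (ha : ‖a‖ ≠ 1) (he : e ∈ unitSphere d)
    (A B : ℝ) :
    ∃ μ₁ μ₂ : Measure (EuclideanSpace ℝ (Fin (d + 1))), IsFiniteMeasure μ₁ ∧ IsFiniteMeasure μ₂ ∧
      (∀ᵐ x ∂μ₁, x ∈ unitSphere d) ∧ (∀ᵐ x ∂μ₂, x ∈ unitSphere d) ∧
      (∀ E, MeasurableSet E → μ₁.real E - μ₂.real E =
        ∫ y in E, (A - B * kelvinDensity d s a y) ∂sphereMeasure d) ∧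
      ∀ x ∈ unitSphere d, potential s μ₁ x ≠ ∞ ∧ potential s μ₂ x ≠ ∞ ∧
        (potential s μ₁ x).toReal - (potential s μ₂ x).toReal =
          (potential s (sphereMeasure d) e).toReal * (A - B * dist x a ^ (-s)) := by
  have := isFiniteMeasure_kelvinMeasure hs hsd ha
  have hA : ((A.toNNReal : ℝ) - ((-A).toNNReal : ℝ)) = A := by
    simp [Real.coe_toNNReal', max_zero_sub_max_neg_zero_eq_self]
  have hB : ((B.toNNReal : ℝ) - ((-B).toNNReal : ℝ)) = B := by
    simp [Real.coe_toNNReal', max_zero_sub_max_neg_zero_eq_self]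
  have hκ : ∀ᵐ x ∂kelvinMeasure d s a, x ∈ unitSphere d :=
    (withDensity_absolutelyContinuous _ _).ae_le ae_mem_unitSphere
  have hsupp : ∀ b c : NNReal, ∀ᵐ x ∂(b • sphereMeasure d + c • kelvinMeasure d s a),
      x ∈ unitSphere d := fun b c ↦ by
    rw [ae_add_measure_iff]
    exact ⟨Measure.ae_smul_measure ae_mem_unitSphere b, Measure.ae_smul_measure hκ c⟩
  have hreal : ∀ b c : NNReal, ∀ E, (b • sphereMeasure d + c • kelvinMeasure d s a).real E =
      b * (sphereMeasure d).real E + c * (kelvinMeasure d s a).real E := fun b c E ↦ by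
    rw [measureReal_add_apply, measureReal_nnreal_smul_apply, measureReal_nnreal_smul_apply]
  have hpot : ∀ b c : NNReal, ∀ x ∈ unitSphere d,
      potential s (b • sphereMeasure d + c • kelvinMeasure d s a) x ≠ ∞ ∧
      (potential s (b • sphereMeasure d + c • kelvinMeasure d s a) x).toReal =
        (potential s (sphereMeasure d) e).toReal * (b + c * dist x a ^ (-s)) := by
    intro b c x hx
    have hfin := potential_sphereMeasure_ne_top hs hsd he
    have hd : 0 < dist x a :=
      dist_pos.2 (ne_of_mem_unitSphere ha (mem_sphere_zero_iff_norm.1 hx))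
    rw [potential_add, potential_nnreal_smul, potential_nnreal_smul, potential_kelvinMeasure ha hx,
      potential_sphereMeasure_eq s hx he, edist_dist, ENNReal.ofReal_rpow_of_pos hd]
    have h1 : (b : ℝ≥0∞) * potential s (sphereMeasure d) e ≠ ∞ := ENNReal.mul_ne_top (by simp) hfin
    have h2 : (c : ℝ≥0∞) * (potential s (sphereMeasure d) e *
        ENNReal.ofReal (dist x a ^ (-s))) ≠ ∞ :=
      ENNReal.mul_ne_top (by simp) (ENNReal.mul_ne_top hfin (by simp))
    refine ⟨ENNReal.add_ne_top.2 ⟨h1, h2⟩, ?_⟩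
    rw [ENNReal.toReal_add h1 h2, ENNReal.toReal_mul, ENNReal.toReal_mul, ENNReal.toReal_mul,
      ENNReal.toReal_ofReal (by positivity), ENNReal.coe_toReal, ENNReal.coe_toReal]
    ring
  refine ⟨A.toNNReal • sphereMeasure d + (-B).toNNReal • kelvinMeasure d s a,
    (-A).toNNReal • sphereMeasure d + B.toNNReal • kelvinMeasure d s a, inferInstance, inferInstance,
    hsupp _ _, hsupp _ _, fun E hE ↦ ?_, fun x hx ↦ ⟨(hpot _ _ x hx).1, (hpot _ _ x hx).1, ?_⟩⟩
  · rw [hreal, hreal, integral_sub (integrable_const _)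
      (((integrable_kelvinDensity hs hsd ha).const_mul B).integrableOn), integral_const_mul,
      ← kelvinMeasure_real s a hE, integral_const, measureReal_restrict_apply MeasurableSet.univ,
      univ_inter, smul_eq_mul]
    linear_combination (sphereMeasure d).real E * hA - (kelvinMeasure d s a).real E * hB
  · rw [(hpot _ _ x hx).2, (hpot _ _ x hx).2]
    linear_combination (potential s (sphereMeasure d) e).toReal * hA -
      (potential s (sphereMeasure d) e).toReal * dist x a ^ (-s) * hB

/-- A signed measure with a density that is continuous on the sphere is nonnegative exactly when
the density is, since the surface measure charges every open set that meets the sphere. -/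
lemma nonneg_iff_kelvin (hs : 0 < s) (hsd : s < d) (ha : ‖a‖ ≠ 1) {A B : ℝ}
    {η : SignedMeasure (EuclideanSpace ℝ (Fin (d + 1)))}
    (hη : ∀ E, MeasurableSet E → η E =
      ∫ y in E, (A - B * kelvinDensity d s a y) ∂sphereMeasure d) :
    0 ≤ η ↔ ∀ y ∈ unitSphere d, B * kelvinDensity d s a y ≤ A := by
  have hint : Integrable (fun y ↦ A - B * kelvinDensity d s a y) (sphereMeasure d) :=
    (integrable_const _).sub ((integrable_kelvinDensity hs hsd ha).const_mul B)
  rw [VectorMeasure.le_iff]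
  constructor
  · intro h y hy
    have hae := ae_nonneg_of_forall_setIntegral_nonneg hint fun E hE _ ↦ by
      rw [← hη E hE]; exact h E hE
    by_contra! hlt
    have hcont : ContinuousOn (fun y ↦ A - B * kelvinDensity d s a y) {a}ᶜ := by
      intro z hz
      have hz' : 0 < dist z a := dist_pos.2 hz
      refine ContinuousAt.continuousWithinAt ?_
      unfold kelvinDensity
      refine continuousAt_const.sub (continuousAt_const.mul (continuousAt_const.div ?_
        (Real.rpow_pos_of_pos hz' _).ne'))
      exact (continuousAt_id.dist continuousAt_const).rpow_const (Or.inl hz'.ne')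
    have hopen : IsOpen ({a}ᶜ ∩ (fun y ↦ A - B * kelvinDensity d s a y) ⁻¹' Iio 0) :=
      hcont.isOpen_inter_preimage isOpen_compl_singleton isOpen_Iio
    have hpos := sphereMeasure_pos_of_isOpen hopen ⟨y, ⟨ne_of_mem_unitSphere ha
      (mem_sphere_zero_iff_norm.1 hy), by simpa using hlt⟩, hy⟩
    refine hpos.ne' (measure_mono_null ?_ hae)
    rintro z ⟨-, hz⟩
    simpa using hz
  · intro h E hE
    rw [hη E hE]
    refine integral_nonneg_of_ae (ae_restrict_of_ae ?_)
    filter_upwards [ae_mem_unitSphere] with y hy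
    simpa using h y hy

/-! ### The Kelvin density at the poles -/

lemma norm_source {R : ℝ} (hR : 0 < R) : ‖source d R‖ = R := by
  simp [source, hR.le]

/-- On the sphere, `kelvinDensity` is a decreasing function of the distance to `a`. -/
lemma kelvinDensity_lt_of_dist_lt (hs : 0 < s) (hsd : s < d) (ha : ‖a‖ ≠ 1)
    {x y : EuclideanSpace ℝ (Fin (d + 1))} (hx : x ∈ unitSphere d) (h : dist x a < dist y a) :
    kelvinDensity d s a y < kelvinDensity d s a x := by
  have hk : 0 < |‖a‖ ^ 2 - 1| := abs_pos.2 (norm_sq_sub_one_ne_zero ha)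
  have hx' : 0 < dist x a := dist_pos.2 (ne_of_mem_unitSphere ha (mem_sphere_zero_iff_norm.1 hx))
  unfold kelvinDensity
  refine div_lt_div_of_pos_left (by positivity) (by positivity) ?_
  exact Real.rpow_lt_rpow hx'.le h (by linarith)

lemma dist_source_sq {R : ℝ} {y : EuclideanSpace ℝ (Fin (d + 1))}
    (hy : y ∈ unitSphere d) :
    dist y (source d R) ^ 2 = 1 + R ^ 2 - 2 * R * inner ℝ y (source d 1) := by
  have h1 : source d R = R • source d 1 := by
    ext i
    simp [source]
  rw [dist_eq_norm, norm_sub_sq_real, mem_sphere_zero_iff_norm.1 hy, h1, inner_smul_right, norm_smul,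
    norm_source one_pos, mul_one, Real.norm_eq_abs, sq_abs]
  ring

lemma kelvinDensity_lt_north (hs : 0 < s) (hsd : s < d) {R : ℝ} (hR : 0 < R) (hR1 : R ≠ 1)
    {y : EuclideanSpace ℝ (Fin (d + 1))} (hy : y ∈ unitSphere d) (hne : y ≠ source d 1) :
    kelvinDensity d s (source d R) y < kelvinDensity d s (source d R) (source d 1) := by
  have hN : source d 1 ∈ unitSphere d := by simp [norm_source]
  refine kelvinDensity_lt_of_dist_lt hs hsd (by rwa [norm_source hR]) hN
    (lt_of_pow_lt_pow_left₀ 2 dist_nonneg ?_)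
  rw [dist_source_sq hy, dist_source_sq hN, real_inner_self_eq_norm_sq, norm_source one_pos]
  have h1 : inner ℝ y (source d 1) < 1 := inner_lt_one_iff_real_of_norm_eq_one
    (mem_sphere_zero_iff_norm.1 hy) (norm_source one_pos) |>.2 hne
  nlinarith

lemma kelvinDensity_south_lt (hs : 0 < s) (hsd : s < d) {R : ℝ} (hR : 0 < R) (hR1 : R ≠ 1)
    {y : EuclideanSpace ℝ (Fin (d + 1))} (hy : y ∈ unitSphere d) (hne : y ≠ -source d 1) :
    kelvinDensity d s (source d R) (-source d 1) < kelvinDensity d s (source d R) y := by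
  have hS : -source d 1 ∈ unitSphere d := by simp [norm_source]
  refine kelvinDensity_lt_of_dist_lt hs hsd (by rwa [norm_source hR]) hy
    (lt_of_pow_lt_pow_left₀ 2 dist_nonneg ?_)
  rw [dist_source_sq hy, dist_source_sq hS, inner_neg_left, real_inner_self_eq_norm_sq,
    norm_source one_pos]
  have h1 : inner ℝ y (-source d 1) < 1 := inner_lt_one_iff_real_of_norm_eq_one
    (mem_sphere_zero_iff_norm.1 hy) (by simp [norm_source]) |>.2 hne
  rw [inner_neg_right] at h1
  nlinarith

lemma kelvinDensity_north {R : ℝ} (hR : 0 < R) (hR1 : R ≠ 1) :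
    kelvinDensity d s (source d R) (source d 1) = (R + 1) ^ ((d : ℝ) - s) / |R - 1| ^ d := by
  have hN : source d 1 ∈ unitSphere d := by simp [norm_source]
  have hpos : 0 < |R - 1| := abs_pos.2 (sub_ne_zero.2 hR1)
  have hd : dist (source d 1) (source d R) = |R - 1| := by
    rw [← sq_eq_sq₀ dist_nonneg hpos.le, dist_source_sq hN, real_inner_self_eq_norm_sq,
      norm_source one_pos, sq_abs]
    ring
  rw [kelvinDensity, hd, norm_source hR, show R ^ 2 - 1 = (R + 1) * (R - 1) by ring, abs_mul,
    abs_of_pos (by linarith : 0 < R + 1), Real.mul_rpow (by positivity) hpos.le,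
    show 2 * (d : ℝ) - s = (d - s) + d by ring, Real.rpow_add hpos, Real.rpow_natCast]
  field_simp

lemma kelvinDensity_south {R : ℝ} (hR : 0 < R) :
    kelvinDensity d s (source d R) (-source d 1) = |R - 1| ^ ((d : ℝ) - s) / (R + 1) ^ d := by
  have hS : -source d 1 ∈ unitSphere d := by simp [norm_source]
  have hpos : 0 < R + 1 := by linarith
  have hd : dist (-source d 1) (source d R) = R + 1 := by
    rw [← sq_eq_sq₀ dist_nonneg hpos.le, dist_source_sq hS, inner_neg_left,
      real_inner_self_eq_norm_sq, norm_source one_pos]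
    ring
  rw [kelvinDensity, hd, norm_source hR, show R ^ 2 - 1 = (R + 1) * (R - 1) by ring, abs_mul,
    abs_of_pos hpos, Real.mul_rpow hpos.le (abs_nonneg _),
    show 2 * (d : ℝ) - s = (d - s) + d by ring, Real.rpow_add hpos, Real.rpow_natCast]
  field_simp

end Equilibrium

/-! ### The signed equilibrium -/

section MainResult

variable {d : ℕ} {s q R : ℝ}

/-- Uniqueness of the signed equilibrium. The Jordan parts of two equilibria combine to positive
measures whose potentials differ by a constant on the sphere. -/
lemma IsSignedEquilibrium.eq (hs : 0 < s) (hsd : s < d)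
    {Q : EuclideanSpace ℝ (Fin (d + 1)) → ℝ}
    {η η' : SignedMeasure (EuclideanSpace ℝ (Fin (d + 1)))}
    (hη : IsSignedEquilibrium s (unitSphere d) Q η)
    (hη' : IsSignedEquilibrium s (unitSphere d) Q η') : η' = η := by
  obtain ⟨G, hG⟩ := hη.const
  obtain ⟨G', hG'⟩ := hη'.const
  have hS : MeasurableSet (unitSphere d) := Metric.isClosed_sphere.measurableSet
  obtain ⟨hP, hN⟩ := posPart_negPart_compl_eq_zero hS hη.supported
  obtain ⟨hP', hN'⟩ := posPart_negPart_compl_eq_zero hS hη'.supported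
  have hJ := η.toSignedMeasure_toJordanDecomposition
  have hJ' := η'.toSignedMeasure_toJordanDecomposition
  rw [JordanDecomposition.toSignedMeasure] at hJ hJ'
  have hfin : ∀ x ∈ unitSphere d, potential s η.toJordanDecomposition.posPart x ≠ ∞ ∧
      potential s η.toJordanDecomposition.negPart x ≠ ∞ := fun x hx ↦ by
    have h := hη.potential_ne_top x hx
    rwa [SignedMeasure.totalVariation, potential_add, ENNReal.add_ne_top] at h
  have hfin' : ∀ x ∈ unitSphere d, potential s η'.toJordanDecomposition.posPart x ≠ ∞ ∧
      potential s η'.toJordanDecomposition.negPart x ≠ ∞ := fun x hx ↦ by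
    have h := hη'.potential_ne_top x hx
    rwa [SignedMeasure.totalVariation, potential_add, ENNReal.add_ne_top] at h
  set P := η.toJordanDecomposition.posPart
  set N := η.toJordanDecomposition.negPart
  set P' := η'.toJordanDecomposition.posPart
  set N' := η'.toJordanDecomposition.negPart
  have hmass : P.real univ - N.real univ = P'.real univ - N'.real univ := by
    have h := hη.total_charge
    have h' := hη'.total_charge
    rw [← hJ, Measure.toSignedMeasure_sub_apply MeasurableSet.univ] at h
    rw [← hJ', Measure.toSignedMeasure_sub_apply MeasurableSet.univ] at h'
    rw [h, h']
  have hkey : P' + N = N' + P := by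
    refine eq_of_potential_sub_eq_const (c := G' - G) hs hsd
      (ae_add_measure_iff.2 ⟨hP', hN⟩) (ae_add_measure_iff.2 ⟨hN', hP⟩) ?_ ?_ ?_ ?_
    · rw [← measureReal_eq_measureReal_iff, measureReal_add_apply, measureReal_add_apply]
      linarith
    · intro x hx
      rw [potential_add]
      exact ENNReal.add_ne_top.2 ⟨(hfin' x hx).1, (hfin x hx).2⟩
    · intro x hx
      rw [potential_add]
      exact ENNReal.add_ne_top.2 ⟨(hfin' x hx).2, (hfin x hx).1⟩
    · intro x hx
      rw [potential_add, potential_add, ENNReal.toReal_add (hfin' x hx).1 (hfin x hx).2,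
        ENNReal.toReal_add (hfin' x hx).2 (hfin x hx).1]
      have e := hG x hx
      have e' := hG' x hx
      rw [signedPotential] at e e'
      linarith
  have hsm : P'.toSignedMeasure + N.toSignedMeasure = N'.toSignedMeasure + P.toSignedMeasure := by
    rw [← Measure.toSignedMeasure_add, ← Measure.toSignedMeasure_add]
    exact Measure.toSignedMeasure_eq_toSignedMeasure_iff.2 hkey
  rw [← hJ, ← hJ', sub_eq_sub_iff_add_eq_add]
  exact hsm.trans (add_comm _ _)

/-- The explicit signed equilibrium: its density is
`A - B * kelvinDensity d s a` with `A = (W + q U) / W` and `B = q / W`, where `W` and `U` are the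
potentials of the surface measure on the sphere and at the source `a`. -/
lemma exists_isSignedEquilibrium (hs : 0 < s) (hsd : s < d) (hR0 : 0 < R) (hR1 : R ≠ 1) {W U : ℝ}
    (hW : W = (minEnergy s (unitSphere d)).toReal)
    (hU : U = (potential s (sphereMeasure d) (source d R)).toReal) (hW0 : 0 < W) :
    ∃ η : SignedMeasure (EuclideanSpace ℝ (Fin (d + 1))),
      IsSignedEquilibrium s (unitSphere d) (field d s q R) η ∧
      ∀ E, MeasurableSet E → η E =
        ∫ y in E, ((W + q * U) / W - q / W * kelvinDensity d s (source d R) y) ∂sphereMeasure d := by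
  have ha : ‖source d R‖ ≠ 1 := by rwa [norm_source hR0]
  obtain ⟨e, he⟩ : (unitSphere d).Nonempty := NormedSpace.sphere_nonempty.2 zero_le_one
  rw [minEnergy_unitSphere hs hsd he] at hW
  obtain ⟨μ₁, μ₂, _, _, h₁, h₂, hreal, hpot⟩ :=
    exists_sub_eq_kelvin hs hsd ha he ((W + q * U) / W) (q / W)
  have hη : ∀ E, MeasurableSet E → (μ₁.toSignedMeasure - μ₂.toSignedMeasure) E =
      ∫ y in E, ((W + q * U) / W - q / W * kelvinDensity d s (source d R) y) ∂sphereMeasure d :=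
    fun E hE ↦ by rw [Measure.toSignedMeasure_sub_apply hE, hreal E hE]
  refine ⟨μ₁.toSignedMeasure - μ₂.toSignedMeasure, ⟨fun B hB hdisj ↦ ?_, ?_, fun x hx ↦
    potential_totalVariation_ne_top rfl (hpot x hx).1 (hpot x hx).2.1, W + q * U, fun x hx ↦ ?_⟩, hη⟩
  · rw [hη B hB, setIntegral_measure_zero]
    exact measure_mono_null hdisj.subset_compl_right sphereMeasure_compl_unitSphere
  · rw [hη _ MeasurableSet.univ, Measure.restrict_univ, integral_sub (integrable_const _)
      ((integrable_kelvinDensity hs hsd ha).const_mul _), integral_const_mul,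
      integral_kelvinDensity hs hsd ha, ← hU]
    simp
    field_simp
    ring
  · have hd : 0 < dist x (source d R) :=
      dist_pos.2 (ne_of_mem_unitSphere ha (mem_sphere_zero_iff_norm.1 hx))
    rw [signedPotential_eq_sub rfl (hpot x hx).1 (hpot x hx).2.1, (hpot x hx).2.2, ← hW, field,
      Real.rpow_neg hd.le]
    field_simp
    ring

/-- A signed equilibrium whose density is positive off one point `p` is a probability measure with
full support, and it is the unique extremal measure. -/
lemma exists_extremal_of_nonneg (hs : 0 < s) (hsd : s < d) (hR0 : 0 < R) (hR1 : R ≠ 1)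
    {A B : ℝ} {η : SignedMeasure (EuclideanSpace ℝ (Fin (d + 1)))}
    (hη : IsSignedEquilibrium s (unitSphere d) (field d s q R) η)
    (hdens : ∀ E, MeasurableSet E → η E =
      ∫ y in E, (A - B * kelvinDensity d s (source d R) y) ∂sphereMeasure d)
    {p : EuclideanSpace ℝ (Fin (d + 1))} (hp : p ∈ unitSphere d)
    (hpos : ∀ y ∈ unitSphere d, y ≠ p → B * kelvinDensity d s (source d R) y < A) :
    ∃ μ : ProbabilityMeasure (EuclideanSpace ℝ (Fin (d + 1))),
      (μ : Measure (EuclideanSpace ℝ (Fin (d + 1)))).toSignedMeasure = η ∧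
      (μ : Measure (EuclideanSpace ℝ (Fin (d + 1)))).support = unitSphere d ∧
      ∀ ν : ProbabilityMeasure (EuclideanSpace ℝ (Fin (d + 1))),
        IsExtremal s (unitSphere d) (field d s q R) ν ↔ ν = μ := by
  have ha : ‖source d R‖ ≠ 1 := by rwa [norm_source hR0]
  set g := fun y ↦ A - B * kelvinDensity d s (source d R) y with hg
  have hgmeas : Measurable g := by fun_prop
  have hgint : Integrable g (sphereMeasure d) :=
    (integrable_const _).sub ((integrable_kelvinDensity hs hsd ha).const_mul B)
  have hgpos : ∀ᵐ y ∂sphereMeasure d, 0 < g y := by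
    have hne : ∀ᵐ y ∂sphereMeasure d, y ≠ p := by
      rw [ae_iff]
      simpa using sphereMeasure_singleton hs hsd hp
    filter_upwards [ae_mem_unitSphere, hne] with y hy hyp
    exact sub_pos.2 (hpos y hy hyp)
  set m := (sphereMeasure d).withDensity fun y ↦ ENNReal.ofReal (g y) with hm
  have hmfin : IsFiniteMeasure m := isFiniteMeasure_withDensity_ofReal hgint.2
  have hmreal : ∀ E, MeasurableSet E → m.real E = η E := fun E hE ↦ by
    rw [hdens E hE, integral_eq_lintegral_of_nonneg_ae
      (ae_restrict_of_ae (hgpos.mono fun y hy ↦ hy.le)) hgmeas.aestronglyMeasurable, Measure.real,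
      hm, withDensity_apply _ hE]
  have hmη : m.toSignedMeasure = η := by
    ext E hE
    rw [Measure.toSignedMeasure_apply_measurable hE, hmreal E hE]
  have hmprob : IsProbabilityMeasure m := ⟨by
    have h := hmreal univ MeasurableSet.univ
    rw [hη.total_charge, Measure.real] at h
    exact (ENNReal.toReal_eq_one_iff _).1 h⟩
  have hmS : m (unitSphere d)ᶜ = 0 :=
    withDensity_absolutelyContinuous _ _ sphereMeasure_compl_unitSphere
  have hac : sphereMeasure d ≪ m := withDensity_absolutelyContinuous'
    (by fun_prop) (hgpos.mono fun y hy ↦ by simpa using hy)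
  refine ⟨⟨m, hmprob⟩, hmη, ?_, fun ν ↦ ?_⟩
  · refine Subset.antisymm (Measure.support_subset_of_isClosed Metric.isClosed_sphere hmS) ?_
    refine Subset.trans (fun x hx ↦ ?_) hac.support_mono
    rw [Measure.mem_support_iff_forall]
    intro V hV
    obtain ⟨O, hOV, hO, hxO⟩ := mem_nhds_iff.1 hV
    exact (sphereMeasure_pos_of_isOpen hO ⟨x, hxO, hx⟩).trans_le (measure_mono hOV)
  · obtain ⟨G, hG⟩ := hη.const
    have hsub : η = m.toSignedMeasure - (0 : Measure _).toSignedMeasure := by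
      rw [hmη, Measure.toSignedMeasure_zero, sub_zero]
    have hmfin' : ∀ x ∈ unitSphere d, potential s m x ≠ ∞ := fun x hx ↦ by
      have h := hη.potential_ne_top x hx
      have hJ := posPart_add_eq_negPart_add hsub
      rw [SignedMeasure.totalVariation, potential_add, ENNReal.add_ne_top] at h
      rw [add_zero] at hJ
      refine ne_top_of_le_ne_top h.1 (potential_mono ?_ x)
      rw [hJ]
      exact Measure.le_add_left le_rfl
    have hclose : ∀ x ∈ unitSphere d, |field d s q R x| ≤ |q| / |R - 1| ^ s := by
      intro x hx
      have h1 : |R - 1| ≤ dist x (source d R) := by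
        have := abs_norm_sub_norm_le x (source d R)
        rwa [mem_sphere_zero_iff_norm.1 hx, norm_source hR0, abs_sub_comm, ← dist_eq_norm] at this
      have h2 : 0 < |R - 1| := abs_pos.2 (sub_ne_zero.2 hR1)
      rw [field, abs_div, abs_of_nonneg (Real.rpow_nonneg dist_nonneg _)]
      gcongr
    refine isExtremal_iff_eq (μ := ⟨m, hmprob⟩) (G := G) hs (by unfold field; fun_prop) hclose hmS
      hmfin' (fun x hx ↦ ?_) ν
    rw [← hG x hx, signedPotential_eq_sub hsub (hmfin' x hx) (by simp [potential])]
    simp [potential]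

end MainResult

end Riesz

end

open Riesz in
theorem mainTheorem2 (d : ℕ) (s q R : ℝ) (hs : 0 < s) (hsd : s < d) (hq : q ≠ 0)
    (hR : (0 < R ∧ R < 1) ∨ 1 < R) :
    -- the quantities `W_s(S^d)` and `U_s^{σ_d}(R)` are finite
    Riesz.minEnergy s (Riesz.unitSphere d) ≠ ∞ ∧
    Riesz.potential s (Riesz.sphereMeasure d) (Riesz.source d R) ≠ ∞ ∧
    -- there is exactly one signed equilibrium `η`, and it has the stated properties
    ∃ η : SignedMeasure (EuclideanSpace ℝ (Fin (d + 1))),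
      (∀ η' : SignedMeasure (EuclideanSpace ℝ (Fin (d + 1))),
        Riesz.IsSignedEquilibrium s (Riesz.unitSphere d) (Riesz.field d s q R) η' ↔ η' = η) ∧
      (0 < q →
        (0 ≤ η ↔
          (Riesz.minEnergy s (Riesz.unitSphere d)).toReal / q ≥
            (R + 1) ^ ((d : ℝ) - s) / |R - 1| ^ d -
              (Riesz.potential s (Riesz.sphereMeasure d) (Riesz.source d R)).toReal)) ∧
      (q < 0 →
        (0 ≤ η ↔
          (Riesz.minEnergy s (Riesz.unitSphere d)).toReal / q ≤
            |R - 1| ^ ((d : ℝ) - s) / (R + 1) ^ d -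
              (Riesz.potential s (Riesz.sphereMeasure d) (Riesz.source d R)).toReal)) ∧
      -- if `η` is nonnegative, it has full support and is the unique extremal measure
      (0 ≤ η →
        ∃ μ : ProbabilityMeasure (EuclideanSpace ℝ (Fin (d + 1))),
          (μ : Measure (EuclideanSpace ℝ (Fin (d + 1)))).toSignedMeasure = η ∧
          (μ : Measure (EuclideanSpace ℝ (Fin (d + 1)))).support = Riesz.unitSphere d ∧
          ∀ ν : ProbabilityMeasure (EuclideanSpace ℝ (Fin (d + 1))),
            Riesz.IsExtremal s (Riesz.unitSphere d) (Riesz.field d s q R) ν ↔ ν = μ) := by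
  have hR0 : 0 < R := by rcases hR with h | h <;> linarith
  have hR1 : R ≠ 1 := by rcases hR with h | h <;> [exact h.2.ne; exact h.ne']
  have ha : ‖source d R‖ ≠ 1 := by rwa [norm_source hR0]
  have hN : source d 1 ∈ unitSphere d := by simp [norm_source]
  have hS : -source d 1 ∈ unitSphere d := by simp [norm_source]
  have hWeq := minEnergy_unitSphere hs hsd hN
  have hWtop : minEnergy s (unitSphere d) ≠ ∞ := hWeq ▸ potential_sphereMeasure_ne_top hs hsd hN
  have hW0' : minEnergy s (unitSphere d) ≠ 0 := hWeq ▸ potential_sphereMeasure_ne_zero hs _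
  refine ⟨hWtop, potential_sphereMeasure_ne_top_of_norm_ne_one hs ha, ?_⟩
  set W := (minEnergy s (unitSphere d)).toReal with hW
  set U := (potential s (sphereMeasure d) (source d R)).toReal with hU
  have hW0 : 0 < W := ENNReal.toReal_pos hW0' hWtop
  obtain ⟨η, hη, hdens⟩ := exists_isSignedEquilibrium (q := q) hs hsd hR0 hR1 hW hU hW0
  have hnn := nonneg_iff_kelvin hs hsd ha hdens
  refine ⟨η, fun η' ↦ ⟨hη.eq hs hsd, fun h ↦ h ▸ hη⟩, fun hq0 ↦ ?_, fun hq0 ↦ ?_, fun h0 ↦ ?_⟩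
  · rw [hnn, ← kelvinDensity_north (s := s) (d := d) hR0 hR1]
    have key : ∀ k, q / W * k ≤ (W + q * U) / W ↔ k - U ≤ W / q := fun k ↦ by
      rw [div_mul_eq_mul_div, div_le_div_iff_of_pos_right hW0, le_div_iff₀ hq0]
      constructor <;> intro h <;> linarith
    refine ⟨fun h ↦ (key _).1 (h _ hN), fun h y hy ↦ (key _).2 ?_⟩
    rcases eq_or_ne y (source d 1) with rfl | hne
    · exact h
    · have := kelvinDensity_lt_north hs hsd hR0 hR1 hy hne
      linarith
  · rw [hnn, ← kelvinDensity_south (s := s) (d := d) hR0]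
    have key : ∀ k, q / W * k ≤ (W + q * U) / W ↔ W / q ≤ k - U := fun k ↦ by
      rw [div_mul_eq_mul_div, div_le_div_iff_of_pos_right hW0, div_le_iff_of_neg hq0]
      constructor <;> intro h <;> linarith
    refine ⟨fun h ↦ (key _).1 (h _ hS), fun h y hy ↦ (key _).2 ?_⟩
    rcases eq_or_ne y (-source d 1) with rfl | hne
    · exact h
    · have := kelvinDensity_south_lt hs hsd hR0 hR1 hy hne
      linarith
  · -- the density can vanish only at the pole nearest to (`q > 0`) or farthest from (`q < 0`) `a`
    rcases hq.lt_or_gt with hq0 | hq0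
    · refine exists_extremal_of_nonneg hs hsd hR0 hR1 hη hdens hS fun y hy hne ↦ ?_
      have h1 := hnn.1 h0 _ hS
      have h2 := kelvinDensity_south_lt hs hsd hR0 hR1 hy hne
      have h3 : q / W < 0 := div_neg_of_neg_of_pos hq0 hW0
      nlinarith
    · refine exists_extremal_of_nonneg hs hsd hR0 hR1 hη hdens hN fun y hy hne ↦ ?_
      have h1 := hnn.1 h0 _ hN
      have h2 := kelvinDensity_lt_north hs hsd hR0 hR1 hy hne
      have h3 : 0 < q / W := div_pos hq0 hW0
      nlinarith
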